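/- **Setting.** Let $D=[0,1]\times[0,1]$, $0<\alpha\le 1$, and let $k_1,k_2,k_3,k_4,f$ be continuous real functions on $D$. Let $D_\eta^\alpha$ be the Caputo derivative in $\eta$: $D_\eta^\alpha y(\xi,\eta)=\frac1{\Gamma(1-\alpha)}\int_0^\eta\frac{\partial_r y(\xi,r)}{(\eta-r)^\alpha}\,dr$ for $\alpha<1$, and $D^1_\eta y=\partial_\eta y$. Consider the time-fractional Burgers problem $$Ly(\xi,\eta)=F\bigl(\xi,\eta,y(\xi,\eta),y_\xi(\xi,\eta)\bigr)\ \text{ for all } (\xi,\eta)\in D,\qquad y(\xi,0)=y(0,\eta)=y(1,\eta)=0,\tag{P}$$ where $Ly=D_\eta^\alpha y+k_1y_{\xi\xi}+k_2y+k_3y_\xi$ and $F(\xi,\eta,u,w)=f(\xi,\eta)-k_4(\xi,\eta)\,u\,w$. Let $W=W_2^{(3,2)}(D)$ be the space of functions $y$ on $D$ such that $\partial^3y/\partial\xi^2\partial\eta$ exists and is absolutely continuous on $D$ (in the sense of Carathéodory: it has the form $e+\int_0^\xi a+\int_0^\eta b+\int_0^\xi\!\int_0^\eta c$ with integrable $a,b,c$),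 $\partial^5y/\partial\xi^3\partial\eta^2\in L^2(D)$, $y(\xi,0)=y(0,\eta)=y(1,\eta)=0$, and the norm of the following inner product is finite: $$\langle y,v\rangle_W=\sum_{i=0}^1\int_0^1\partial_\eta^2\partial_\xi^iy(0,\eta)\,\partial_\eta^2\partial_\xi^iv(0,\eta)\,d\eta+\int_0^1\partial_\eta^2y(1,\eta)\,\partial_\eta^2v(1,\eta)\,d\eta+\sum_{j=0}^1\bigl\langle\partial_\eta^jy(\cdot,0),\partial_\eta^jv(\cdot,0)\bigr\rangle_{W_2^3}+\iint_D\partial_\xi^3\partial_\eta^2y\;\partial_\xi^3\partial_\eta^2v\,d\xi\,d\eta,$$ with $\langle g,h\rangle_{W_2^3}=g(0)h(0)+g'(0)h'(0)+g(1)h(1)+\int_0^1g'''h'''$. Its reproducing kernel is $K_{(x,t)}(\xi,\eta)=R^{\{3\}}_x(\xi)R^{\{2\}}_t(\eta)$, where $R^{\{2\}}_t(\eta)=\eta t+\frac12t\eta^2-\frac16\eta^3$ for $\eta\le t$, $R^{\{2\}}_t(\eta)=R^{\{2\}}_\eta(t)$ for $\eta>t$, and $R^{\{3\}}_x(\xi)=-\frac1{120}(x-1)\xi\,(\xi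 x^4-4\xi x^3+6\xi x^2+x\xi^4-5x\xi^3-120x\xi+120x+\xi^4)$ for $\xi\le x$, $R^{\{3\}}_x(\xi)=R^{\{3\}}_\xi(x)$ for $\xi>x$. Let $(\xi_i,\eta_i)_{i\ge1}$ be points of $D$, and put $\psi_i(\xi,\eta)=L_{(x,t)}K_{(x,t)}(\xi,\eta)\big|_{(x,t)=(\xi_i,\eta_i)}$. Let $\overline\psi_i=\sum_{k=1}^i\beta_{ik}\psi_k$ be obtained by Gram–Schmidt orthonormalization of $(\psi_i)$ in $W$, with $\beta_{ii}>0$; if $\psi_i$ is a linear combination of $\psi_1,\dots,\psi_{i-1}$ (for instance if $\psi_i=0$, as for the point $(0,0)$), it is skipped: $\overline\psi_i=0$ and $\beta_{ik}=0$ for all $k$. Given a starting function $y_0$ (for instance $y_0=0$), define the iterates by $$y_n=\sum_{i=1}^nB_i\overline\psi_i\quad(n\ge1),\qquad B_i=\sum_{k=1}^i\beta_{ik}\,F\bigl(\xi_k,\eta_k,y_{k-1}(\xi_k,\eta_k),\partial_\xi y_{k-1}(\xi_k,\eta_k)\bigr).$$ **Theorem 4.1.** Suppose that $\{(\xi_i,\eta_i)\}_{i\ge1}$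 is dense in $D$ and that the norms $\|y_n\|_W$, $n\ge1$, are bounded. Then there is a solution $\hat y\in W$ of (P) such that $\|y_n-\hat y\|_W\to0$ and $$\hat y(\xi,\eta)=\sum_{i=1}^\infty B_i\overline\psi_i(\xi,\eta)\qquad\text{for all }(\xi,\eta)\in D.$$ Consequently, if (P) has at most one solution in $W$, then for the exact solution $y$ of (P) one has $\|y_n-y\|_W\to0$ and $y=\sum_{i=1}^\infty B_i\overline\psi_i$ on $D$. -/

import Mathlib

open Set Filter Topology MeasureTheory

namespace FracBurgers

noncomputable section

/-- The interval `[0,1]`. -/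
abbrev I01 : Set ℝ := Icc 0 1

/-- The square `D = [0,1] × [0,1]`, whose points are written `(ξ, η)`. -/
abbrev D : Set (ℝ × ℝ) := Icc 0 1 ×ˢ Icc 0 1

/-- Derivative of a function on `[0,1]` (one-sided at the end points). -/
def d1 (g : ℝ → ℝ) : ℝ → ℝ := fun x => derivWithin g I01 x

/-- The partial derivative `∂y/∂ξ` on `D`. A function on `D` is represented by a function
`ℝ → ℝ → ℝ`; its values outside `D` never play a role. -/
def pXi (y : ℝ → ℝ → ℝ) : ℝ → ℝ → ℝ := fun ξ η => d1 (fun s => y s η) ξ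

/-- The partial derivative `∂y/∂η` on `D`. -/
def pEta (y : ℝ → ℝ → ℝ) : ℝ → ℝ → ℝ := fun ξ η => d1 (fun t => y ξ t) η

/-! ### Absolutely (completely) continuous functions on the square -/

/-- `c` is a density of the rectangle increments of `v`. It is unique almost everywhere on `D`
and equals `∂²v/∂ξ∂η` almost everywhere. -/
def IsMixedDensity (v : ℝ → ℝ → ℝ) (c : ℝ × ℝ → ℝ) : Prop :=
  IntegrableOn c D ∧ ∀ ξ ∈ I01, ∀ η ∈ I01,
    v ξ η - v ξ 0 - v 0 η + v 0 0 = ∫ z in Icc 0 ξ ×ˢ Icc 0 η, c z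

/-- Absolute continuity of a function of two variables on `D` (in the sense of Carathéodory):
`v ξ η = e + ∫₀^ξ a + ∫₀^η b + ∫₀^ξ ∫₀^η c` with integrable `a`, `b`, `c`. -/
def AbsContOnSquare (v : ℝ → ℝ → ℝ) : Prop :=
  AbsolutelyContinuousOnInterval (fun ξ => v ξ 0) 0 1 ∧
  AbsolutelyContinuousOnInterval (fun η => v 0 η) 0 1 ∧
  ∃ c, IsMixedDensity v c

open Classical in
/-- The almost everywhere defined derivative `∂²v/∂ξ∂η` of an absolutely continuous `v`. -/
def mixedDeriv (v : ℝ → ℝ → ℝ) : ℝ × ℝ → ℝ :=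
  if h : ∃ c, IsMixedDensity v c then h.choose else 0

/-! ### The space `W₂^(3,2)(D)` -/

/-- The derivative `∂³y/∂ξ²∂η`. -/
def d21 (y : ℝ → ℝ → ℝ) : ℝ → ℝ → ℝ := pXi (pXi (pEta y))

/-- Membership in `W₂^(3,2)(D)`: the derivative `∂³y/∂ξ²∂η` exists and is absolutely continuous
on `D`, `∂⁵y/∂ξ³∂η²` is in `L²(D)`, the homogeneous initial and boundary conditions hold, and the
one-dimensional traces that occur in the inner product are square integrable, i.e. the norm of `y`
is finite (the other traces in the inner product vanish by the initial and boundary conditions). -/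
structure MemW (y : ℝ → ℝ → ℝ) : Prop where
  diff_eta : ∀ ξ ∈ I01, DifferentiableOn ℝ (fun t => y ξ t) I01
  diff_xi_eta : ∀ η ∈ I01, DifferentiableOn ℝ (fun s => pEta y s η) I01
  diff_xi_xi_eta : ∀ η ∈ I01, DifferentiableOn ℝ (fun s => pXi (pEta y) s η) I01
  absCont : AbsContOnSquare (d21 y)
  memLp_mixed : MemLp (mixedDeriv (d21 y)) 2 (volume.restrict D)
  memLp_xi : MemLp (fun ξ => pXi (d21 y) ξ 0) 2 (volume.restrict I01)
  memLp_eta : MemLp (fun η => pEta (pEta (pXi y)) 0 η) 2 (volume.restrict I01)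
  initial : ∀ ξ ∈ I01, y ξ 0 = 0
  boundary_left : ∀ η ∈ I01, y 0 η = 0
  boundary_right : ∀ η ∈ I01, y 1 η = 0

/-- The inner product of `W₂³[0,1]`. -/
def innerW3 (g f : ℝ → ℝ) : ℝ :=
  g 0 * f 0 + d1 g 0 * d1 f 0 + g 1 * f 1 + ∫ ξ in (0 : ℝ)..1, d1^[3] g ξ * d1^[3] f ξ

/-- The inner product of `W₂^(3,2)(D)`. -/
def innerW (y v : ℝ → ℝ → ℝ) : ℝ :=
  (∑ i ∈ Finset.range 2,
      ∫ η in (0 : ℝ)..1, pEta^[2] (pXi^[i] y) 0 η * pEta^[2] (pXi^[i] v) 0 η)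
    + (∫ η in (0 : ℝ)..1, pEta^[2] y 1 η * pEta^[2] v 1 η)
    + (∑ j ∈ Finset.range 2,
        innerW3 (fun ξ => pEta^[j] y ξ 0) (fun ξ => pEta^[j] v ξ 0))
    + ∫ z in D, mixedDeriv (d21 y) z * mixedDeriv (d21 v) z

/-- The norm of `W₂^(3,2)(D)`. -/
def normW (y : ℝ → ℝ → ℝ) : ℝ := Real.sqrt (innerW y y)

/-! ### The reproducing kernel of `W₂^(3,2)(D)` -/

/-- The reproducing kernel of `W₂²[0,1]`, as the function `η ↦ R_t(η)`. -/
def R2 (t η : ℝ) : ℝ :=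
  if η ≤ t then η * t + 1 / 2 * t * η ^ 2 - 1 / 6 * η ^ 3
  else -(1 / 6) * t ^ 3 + 1 / 2 * η * t ^ 2 + t * η

/-- The reproducing kernel of `W₂³[0,1]`, as the function `ξ ↦ R_x(ξ)`. -/
def R3 (x ξ : ℝ) : ℝ :=
  if ξ ≤ x then
    -(1 / 120) * (x - 1) * ξ * (ξ * x ^ 4 - 4 * ξ * x ^ 3 + 6 * ξ * x ^ 2 + x * ξ ^ 4
      - 5 * x * ξ ^ 3 - 120 * x * ξ + 120 * x + ξ ^ 4)
  else
    -(1 / 120) * (ξ - 1) * x * (x * ξ ^ 4 - 4 * x * ξ ^ 3 + 6 * x * ξ ^ 2 + ξ * x ^ 4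
      - 5 * ξ * x ^ 3 - 120 * ξ * x + 120 * ξ + x ^ 4)

/-- The reproducing kernel `K_(x,t)(ξ,η)` of `W₂^(3,2)(D)`. -/
def K (x t ξ η : ℝ) : ℝ := R3 x ξ * R2 t η

/-! ### The fractional Burgers problem -/

/-- The Caputo derivative of order `α ∈ (0,1]` on `[0,1]`; for `α = 1` it is the derivative. -/
def caputo (α : ℝ) (g : ℝ → ℝ) (η : ℝ) : ℝ :=
  if α = 1 then d1 g η
  else 1 / Real.Gamma (1 - α) * ∫ r in (0 : ℝ)..η, d1 g r / (η - r) ^ α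

/-- The linear operator `L y = D_η^α y + k₁ y_ξξ + k₂ y + k₃ y_ξ`. -/
def opL (α : ℝ) (k₁ k₂ k₃ : ℝ → ℝ → ℝ) (y : ℝ → ℝ → ℝ) (ξ η : ℝ) : ℝ :=
  caputo α (fun t => y ξ t) η + k₁ ξ η * pXi (pXi y) ξ η + k₂ ξ η * y ξ η
    + k₃ ξ η * pXi y ξ η

/-- The right-hand side `F(ξ,η,y,y_ξ) = f(ξ,η) - k₄(ξ,η) y y_ξ`. -/
def rhsF (k₄ f : ℝ → ℝ → ℝ) (ξ η u w : ℝ) : ℝ := f ξ η - k₄ ξ η * u * w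

/-- `u` is a solution in `W₂^(3,2)(D)` of the problem `L u = F(ξ,η,u,u_ξ)` on `D`; the initial
and boundary conditions are part of the membership in the space. -/
def IsSolution (α : ℝ) (k₁ k₂ k₃ k₄ f : ℝ → ℝ → ℝ) (u : ℝ → ℝ → ℝ) : Prop :=
  MemW u ∧ ∀ ξ ∈ I01, ∀ η ∈ I01,
    opL α k₁ k₂ k₃ u ξ η = rhsF k₄ f ξ η (u ξ η) (pXi u ξ η)

/-! ### The orthonormal system -/

/-- `ψ_i(ξ,η) = L_(x,t) K_(x,t)(ξ,η)` at `(x,t) = p_i`. -/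
def psi (α : ℝ) (k₁ k₂ k₃ : ℝ → ℝ → ℝ) (p : ℕ → ℝ × ℝ) (i : ℕ) : ℝ → ℝ → ℝ :=
  fun ξ η => opL α k₁ k₂ k₃ (fun x t => K x t ξ η) (p i).1 (p i).2

/-- The Gram–Schmidt coefficients `β_ik` of a sequence `ψ` with respect to the inner product of
`W₂^(3,2)(D)`. With `ψ̄_j = ∑_{k ≤ j} β_jk ψ_k` for `j < i`, the numbers `γ_k` are the coefficients
of `ψ_i - ∑_{j < i} ⟨ψ_i, ψ̄_j⟩ ψ̄_j` in terms of the `ψ_k`, and `β_ik = γ_k / ‖∑_k γ_k ψ_k‖`.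
So `β_ii > 0`, unless `ψ_i` is a linear combination of its predecessors: then the row
`β_i` is zero (division by zero) and `ψ̄_i = 0`. -/
def gsCoeff (ψ : ℕ → ℝ → ℝ → ℝ) (i : ℕ) : ℕ → ℝ :=
  let bar : Fin i → ℝ → ℝ → ℝ := fun j =>
    ∑ k ∈ Finset.range (j.1 + 1), gsCoeff ψ j.1 k • ψ k
  let γ : ℕ → ℝ := fun k =>
    (if k = i then 1 else 0) - ∑ j : Fin i, innerW (ψ i) (bar j) * gsCoeff ψ j.1 k
  fun k => γ k / normW (∑ l ∈ Finset.range (i + 1), γ l • ψ l)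
termination_by i
decreasing_by all_goals exact j.2

/-- The orthonormal system `ψ̄_i = ∑_{k ≤ i} β_ik ψ_k`. -/
def gsBar (ψ : ℕ → ℝ → ℝ → ℝ) (i : ℕ) : ℝ → ℝ → ℝ :=
  ∑ k ∈ Finset.range (i + 1), gsCoeff ψ i k • ψ k

/-- The iterative scheme for the iterates `y_n` and the coefficients `B_i`. The points, the `ψ_i`
and the `B_i` are numbered from `0` here, so that `p i`, `B i` stand for the `(i+1)`-st point and
coefficient, while `y n` is the `n`-th iterate: the iterate `y_k` is evaluated at the point number
`k+1`, and `y_{n+1}` is the sum of the first `n+1` terms. The start `y 0` is arbitrary. -/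
structure IsIteration (α : ℝ) (k₁ k₂ k₃ k₄ f : ℝ → ℝ → ℝ) (p : ℕ → ℝ × ℝ)
    (y : ℕ → ℝ → ℝ → ℝ) (B : ℕ → ℝ) : Prop where
  coeff : ∀ i, B i = ∑ k ∈ Finset.range (i + 1), gsCoeff (psi α k₁ k₂ k₃ p) i k *
    rhsF k₄ f (p k).1 (p k).2 (y k (p k).1 (p k).2) (pXi (y k) (p k).1 (p k).2)
  iterate : ∀ n, y (n + 1) =
    ∑ i ∈ Finset.range (n + 1), B i • gsBar (psi α k₁ k₂ k₃ p) i

end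

end FracBurgers

open FracBurgers

/-! The space is replaced by an L² space. Let μ be a unit mass at 0 plus Lebesgue measure on [0,1].
The side conditions annihilate most terms of the inner product. What remains involves ∂_ξ∂_η y(0,0),
∂_ξ∂_η² y(0,·), ∂_ξ³∂_η y(·,0) and ∂_ξ³∂_η² y, and these four data form one element c of L²(μ ⊗ μ).
Every such c yields y(ξ,η) = ⟪c, Φ(ξ) ⊗ Ψ(η)⟫ (`Repr`), a member of W (`Repr.memW`) with the same
inner products (`innerW_eq`); only this direction is needed. In these coordinates K is the Gram
kernel of Φ ⊗ Ψ, and Ly(z) = ⟪c, `ell` z⟫ with `ell` continuous on D, so ψ_i has coordinates `ell`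
(p i).

Orthogonality turns the bound on ‖y_n‖ into convergence of ∑ B_i², so the series converges in norm
to some c (`summable_of_bounded`); let u be its function. The numbers F_k = F(p_k, y_k, ∂_ξ y_k)
enter the B_i through a triangular system, hence Lu(p_k) = F_k at every k not skipped by
Gram–Schmidt (`inner_of_hasSum`). The nonlinearity plays no role here. Now let k tend to infinity
along unskipped indices with p_k → z: the values of y_k and ∂_ξ y_k at p_k tend to those of u and
∂_ξ u at z, and the equation at z follows by continuity.

This needs unskipped points of large index near every z. By `ell_notMem_span`, `ell` at an interior
point is independent of its values at finitely many other points. The test function is a bump in ξ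
times a ramp in η that starts at s just below a point of height τ. The bump is locally constant, so
the k₁ and k₃ terms vanish; the Caputo term, of order (τ-s)^(2-α), beats the k₂ term, of order
(τ-s)². -/

namespace FracBurgers

noncomputable section

open scoped RealInnerProductSpace

/-! ### The coordinate L² spaces and tensor products. -/

/-- A point mass at `0` together with Lebesgue measure on `[0,1]`. -/
def refMeasure : Measure ℝ := Measure.dirac 0 + volume.restrict I01

instance : IsFiniteMeasure refMeasure := by unfold refMeasure; infer_instance

/-- The coordinate space of `W₂²[0,1]` and `W₂³[0,1]`. -/
abbrev H1 := Lp ℝ 2 refMeasure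

/-- The coordinate space of `W₂^(3,2)(D)`. -/
abbrev H2 := Lp ℝ 2 (refMeasure.prod refMeasure)

theorem memLp_tens (f g : H1) :
    MemLp (fun z : ℝ × ℝ => f z.1 * g z.2) 2 (refMeasure.prod refMeasure) := by
  have hf := Lp.memLp f
  have hg := Lp.memLp g
  rw [memLp_two_iff_integrable_sq]
  · have := (hf.integrable_sq).mul_prod (hg.integrable_sq)
    refine this.congr (Eventually.of_forall fun z => ?_)
    simp only; ring
  · exact (hf.1.comp_fst).mul (hg.1.comp_snd)

theorem ae_fst {p : ℝ → Prop} (h : ∀ᵐ x ∂refMeasure, p x) :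
    ∀ᵐ z ∂refMeasure.prod refMeasure, p z.1 :=
  Measure.quasiMeasurePreserving_fst.ae h

theorem ae_snd {p : ℝ → Prop} (h : ∀ᵐ x ∂refMeasure, p x) :
    ∀ᵐ z ∂refMeasure.prod refMeasure, p z.2 :=
  Measure.quasiMeasurePreserving_snd.ae h

/-- The tensor product of two functions in `L²`. -/
def tensFun (f g : H1) : H2 := (memLp_tens f g).toLp _

theorem coeFn_tensFun (f g : H1) :
    tensFun f g =ᵐ[refMeasure.prod refMeasure] fun z => f z.1 * g z.2 :=
  (memLp_tens f g).coeFn_toLp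

theorem inner_tensFun (f g f' g' : H1) :
    ⟪tensFun f g, tensFun f' g'⟫ = ⟪f, f'⟫ * ⟪g, g'⟫ := by
  simp only [L2.inner_def]
  rw [← integral_prod_mul]
  refine integral_congr_ae ?_
  filter_upwards [coeFn_tensFun f g, coeFn_tensFun f' g'] with z h1 h2
  simp only [h1, h2, RCLike.inner_apply, conj_trivial]
  ring

theorem norm_tensFun (f g : H1) : ‖tensFun f g‖ = ‖f‖ * ‖g‖ := by
  have h := inner_tensFun f g f g
  simp only [real_inner_self_eq_norm_sq, ← mul_pow] at h
  exact (pow_left_inj₀ (norm_nonneg _) (by positivity) two_ne_zero).1 h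

/-- The tensor product of functions in `L²` as a continuous bilinear map. -/
def tens : H1 →L[ℝ] H1 →L[ℝ] H2 :=
  LinearMap.mkContinuous₂
    (LinearMap.mk₂ ℝ tensFun
      (fun f f' g => by
        refine Lp.ext ?_
        filter_upwards [coeFn_tensFun (f + f') g, coeFn_tensFun f g, coeFn_tensFun f' g,
          Lp.coeFn_add (tensFun f g) (tensFun f' g), ae_fst (Lp.coeFn_add f f')]
          with z h1 h2 h3 h4 h5
        simp only [h1, h4, Pi.add_apply, h2, h3, h5]; ring)
      (fun a f g => by
        refine Lp.ext ?_
        filter_upwards [coeFn_tensFun (a • f) g, coeFn_tensFun f g,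
          Lp.coeFn_smul a (tensFun f g), ae_fst (Lp.coeFn_smul a f)]
          with z h1 h2 h4 h5
        simp only [h1, h4, Pi.smul_apply, h2, h5, smul_eq_mul]; ring)
      (fun f g g' => by
        refine Lp.ext ?_
        filter_upwards [coeFn_tensFun f (g + g'), coeFn_tensFun f g, coeFn_tensFun f g',
          Lp.coeFn_add (tensFun f g) (tensFun f g'), ae_snd (Lp.coeFn_add g g')]
          with z h1 h2 h3 h4 h5
        simp only [h1, h4, Pi.add_apply, h2, h3, h5]; ring)
      (fun a f g => by
        refine Lp.ext ?_
        filter_upwards [coeFn_tensFun f (a • g), coeFn_tensFun f g,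
          Lp.coeFn_smul a (tensFun f g), ae_snd (Lp.coeFn_smul a g)]
          with z h1 h2 h4 h5
        simp only [h1, h4, Pi.smul_apply, h2, h5, smul_eq_mul]; ring))
    1 (fun f g => by simp [LinearMap.mk₂_apply, norm_tensFun])

theorem tens_apply (f g : H1) : tens f g = tensFun f g := rfl

theorem inner_tens (f g f' g' : H1) : ⟪tens f g, tens f' g'⟫ = ⟪f, f'⟫ * ⟪g, g'⟫ :=
  inner_tensFun f g f' g'

/-! ### Indicators of intervals. -/

/-- The class of the indicator function of a measurable set. -/
def ind (s : Set ℝ) (hs : MeasurableSet s) : H1 :=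
  indicatorConstLp 2 hs (measure_ne_top refMeasure s) 1

theorem inner_ind_left (s : Set ℝ) (hs : MeasurableSet s) (f : H1) :
    ⟪ind s hs, f⟫ = ∫ x in s, f x ∂refMeasure :=
  L2.inner_indicatorConstLp_one hs _ f

theorem tens_ind (s t : Set ℝ) (hs : MeasurableSet s) (ht : MeasurableSet t) :
    tens (ind s hs) (ind t ht)
      = indicatorConstLp 2 (hs.prod ht) (measure_ne_top (refMeasure.prod refMeasure) _) 1 := by
  refine Lp.ext ?_
  filter_upwards [coeFn_tensFun (ind s hs) (ind t ht),
    ae_fst (indicatorConstLp_coeFn (p := 2) (hs := hs) (hμs := measure_ne_top refMeasure s)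
      (c := (1 : ℝ))),
    ae_snd (indicatorConstLp_coeFn (p := 2) (hs := ht) (hμs := measure_ne_top refMeasure t)
      (c := (1 : ℝ))),
    indicatorConstLp_coeFn (p := 2) (hs := hs.prod ht)
      (hμs := measure_ne_top (refMeasure.prod refMeasure) _) (c := (1 : ℝ))] with z h1 h2 h3 h4
  rw [tens_apply, h1, h4]
  unfold ind
  rw [h2, h3]
  by_cases a : z.1 ∈ s <;> by_cases b : z.2 ∈ t <;> simp [indicator, a, b, mem_prod]

theorem inner_tens_ind (c : H2) (s t : Set ℝ) (hs : MeasurableSet s) (ht : MeasurableSet t) :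
    ⟪c, tens (ind s hs) (ind t ht)⟫ = ∫ z in s ×ˢ t, c z ∂refMeasure.prod refMeasure := by
  rw [real_inner_comm, tens_ind, L2.inner_indicatorConstLp_one]

/-- The class of the indicator function of `[0,|t|]`. -/
def J (t : ℝ) : H1 := ind (Icc 0 |t|) measurableSet_Icc

theorem refMeasure_real_Icc {s : ℝ} (hs : s ∈ I01) : refMeasure.real (Icc 0 s) = 1 + s := by
  have h : Icc 0 s ∩ I01 = Icc 0 s := inter_eq_left.2 (Icc_subset_Icc_right hs.2)
  rw [measureReal_def, refMeasure, Measure.add_apply, Measure.restrict_apply measurableSet_Icc, h,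
    Measure.dirac_apply' _ measurableSet_Icc, indicator_of_mem (by simp [hs.1]), Real.volume_Icc,
    Pi.one_apply, ENNReal.toReal_add (by simp) (by simp)]
  simp [hs.1]

theorem inner_J_J {s t : ℝ} (hs : s ∈ I01) (ht : t ∈ I01) : ⟪J s, J t⟫ = 1 + min s t := by
  unfold J ind
  rw [L2.real_inner_indicatorConstLp_one_indicatorConstLp_one]
  rw [Icc_inter_Icc, abs_of_nonneg hs.1, abs_of_nonneg ht.1, sup_idem]
  exact refMeasure_real_Icc (by constructor <;> simp [hs.1, ht.1, hs.2])

/-- The absolute value keeps the atom 0 in every interval, so it never lies in a symmetric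
difference, whose measure is at most ||y| - |x||. Continuity on the whole line makes the primitives
below differentiable everywhere, without one-sided derivatives. -/
theorem continuous_J : Continuous J := by
  unfold J ind
  apply continuous_indicatorConstLp_set (by simp)
  intro x
  have hb : ∀ y : ℝ, refMeasure (symmDiff (Icc 0 |y|) (Icc 0 |x|)) ≤ ENNReal.ofReal |(|y| - |x|)| := by
    intro y
    have hsub : symmDiff (Icc 0 |y|) (Icc 0 |x|) ⊆ uIoc |x| |y| := by
      intro z hz
      rw [mem_symmDiff] at hz
      rw [mem_uIoc]
      simp only [mem_Icc, not_and, not_le] at hz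
      rcases hz with h | h
      · exact Or.inl ⟨h.2 h.1.1, h.1.2⟩
      · exact Or.inr ⟨h.2 h.1.1, h.1.2⟩
    refine (measure_mono hsub).trans ?_
    have h0 : (0 : ℝ) ∉ uIoc |x| |y| := by
      rw [mem_uIoc]
      have := abs_nonneg x; have := abs_nonneg y
      rintro (h | h) <;> linarith [h.1]
    rw [refMeasure, Measure.add_apply, Measure.dirac_apply' _ measurableSet_uIoc,
      indicator_of_notMem h0, zero_add]
    refine (Measure.restrict_apply_le _ _).trans ?_
    rw [Real.volume_uIoc]
  refine tendsto_of_tendsto_of_tendsto_of_le_of_le tendsto_const_nhds ?_ (fun _ => zero_le) hb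
  have : Tendsto (fun y : ℝ => |(|y| - |x|)|) (𝓝 x) (𝓝 0) := by
    have : Continuous fun y : ℝ => |(|y| - |x|)| := by fun_prop
    simpa using this.tendsto x
  simpa using ENNReal.tendsto_ofReal this

/-! ### Representers of point evaluation as iterated primitives. -/

/-- The representer `η ↦ Ψ(η)` of point evaluation in `W₂²[0,1]`. -/
def Psi (t : ℝ) : H1 := ∫ r in (0 : ℝ)..t, J r

/-- The second derivative of `Th0`. -/
def Th2 (x : ℝ) : H1 := J x - J 0

/-- The derivative of `Th0`. -/
def Th1 (x : ℝ) : H1 := J 0 + ∫ r in (0 : ℝ)..x, Th2 r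

/-- The representer of point evaluation in the space without the condition at `1`. -/
def Th0 (x : ℝ) : H1 := ∫ r in (0 : ℝ)..x, Th1 r

/-- The representer `ξ ↦ Φ(ξ)` of point evaluation in `W₂³[0,1]`. -/
def Phi (x : ℝ) : H1 := Th0 x - x ^ 2 • Th0 1

/-- The derivative of `Phi`. -/
def Phi1 (x : ℝ) : H1 := Th1 x - (2 * x) • Th0 1

/-- The second derivative of `Phi`. -/
def Phi2 (x : ℝ) : H1 := Th2 x - (2 : ℝ) • Th0 1

theorem hasDerivAt_Psi (t : ℝ) : HasDerivAt Psi (J t) t :=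
  intervalIntegral.integral_hasDerivAt_right (continuous_J.intervalIntegrable _ _)
    (continuous_J.stronglyMeasurableAtFilter _ _) continuous_J.continuousAt

theorem continuous_Th2 : Continuous Th2 := continuous_J.sub continuous_const

theorem hasDerivAt_Th1 (x : ℝ) : HasDerivAt Th1 (Th2 x) x :=
  (intervalIntegral.integral_hasDerivAt_right (continuous_Th2.intervalIntegrable _ _)
    (continuous_Th2.stronglyMeasurableAtFilter _ _) continuous_Th2.continuousAt).const_add _

theorem continuous_Th1 : Continuous Th1 :=
  continuous_iff_continuousAt.2 fun x => (hasDerivAt_Th1 x).continuousAt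

theorem hasDerivAt_Th0 (x : ℝ) : HasDerivAt Th0 (Th1 x) x :=
  intervalIntegral.integral_hasDerivAt_right (continuous_Th1.intervalIntegrable _ _)
    (continuous_Th1.stronglyMeasurableAtFilter _ _) continuous_Th1.continuousAt

theorem hasDerivAt_Phi (x : ℝ) : HasDerivAt Phi (Phi1 x) x := by
  have h := (hasDerivAt_pow 2 x).smul_const (Th0 1)
  exact ((hasDerivAt_Th0 x).sub h).congr_deriv (by simp [Phi1])

theorem hasDerivAt_Phi1 (x : ℝ) : HasDerivAt Phi1 (Phi2 x) x := by
  have h := ((hasDerivAt_id x).const_mul 2).smul_const (Th0 1)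
  exact ((hasDerivAt_Th1 x).sub h).congr_deriv (by simp [Phi2])

theorem continuous_Psi : Continuous Psi :=
  continuous_iff_continuousAt.2 fun x => (hasDerivAt_Psi x).continuousAt

theorem continuous_Phi : Continuous Phi :=
  continuous_iff_continuousAt.2 fun x => (hasDerivAt_Phi x).continuousAt

theorem continuous_Phi1 : Continuous Phi1 :=
  continuous_iff_continuousAt.2 fun x => (hasDerivAt_Phi1 x).continuousAt

theorem continuous_Phi2 : Continuous Phi2 := continuous_Th2.sub continuous_const

theorem Psi_zero : Psi 0 = 0 := by simp [Psi]

theorem Th1_zero : Th1 0 = J 0 := by simp [Th1]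

theorem Th0_zero : Th0 0 = 0 := by simp [Th0]

theorem Phi_zero : Phi 0 = 0 := by simp [Phi, Th0]

/-- Subtracting a multiple of x² enforces the zero at 1 and changes neither the third derivative nor
the value and slope at 0, so the coordinates stay the same. -/
theorem Phi_one : Phi 1 = 0 := by simp [Phi]

theorem Phi1_zero : Phi1 0 = J 0 := by simp [Phi1, Th1]

/-! ### The reproducing kernels -/

theorem eq_of_hasDerivAt_eq {f g f' g' : ℝ → ℝ} (hf : ∀ x, HasDerivAt f (f' x) x)
    (hg : ∀ x, HasDerivAt g (g' x) x) (h : ∀ x ∈ I01, f' x = g' x) (h0 : f 0 = g 0)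
    {x : ℝ} (hx : x ∈ I01) : f x = g x := by
  have hd : ∀ y, HasDerivAt (fun y => f y - g y) (f' y - g' y) y := fun y => (hf y).sub (hg y)
  have := constant_of_has_deriv_right_zero (f := fun y => f y - g y) (a := 0) (b := 1)
    (fun y _ => (hd y).continuousAt.continuousWithinAt)
    (fun y hy => by
      have := (hd y).hasDerivWithinAt (s := Ici y)
      rwa [h y ⟨hy.1, hy.2.le⟩, sub_self] at this) x hx
  linarith

/-- Powers of positive parts express both branches of the kernels in one formula. From exponent 2 on
they are differentiable at the corner too. -/
theorem hasDerivAt_posPart_pow (n : ℕ) (x : ℝ) :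
    HasDerivAt (fun z : ℝ => max z 0 ^ (n + 2)) ((n + 2) * max x 0 ^ (n + 1)) x := by
  rcases lt_trichotomy x 0 with h | h | h
  · rw [max_eq_right h.le]
    have : (fun z : ℝ => max z 0 ^ (n + 2)) =ᶠ[𝓝 x] fun _ => 0 := by
      filter_upwards [Iio_mem_nhds h] with z hz
      rw [max_eq_right (le_of_lt hz)]; simp
    simpa using (hasDerivAt_const x (0 : ℝ)).congr_of_eventuallyEq this
  · subst h
    rw [hasDerivAt_iff_isLittleO_nhds_zero]
    simp only [zero_add, max_self, ne_eq, Nat.add_eq_zero_iff, OfNat.ofNat_ne_zero, and_false,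
      not_false_eq_true, zero_pow, sub_zero, one_ne_zero, mul_zero, smul_zero]
    have : (fun h : ℝ => max h 0 ^ (n + 2)) =O[𝓝 0] fun h : ℝ => h ^ (n + 2) := by
      refine Asymptotics.IsBigO.of_bound 1 (Eventually.of_forall fun z => ?_)
      rw [one_mul, norm_pow, norm_pow]
      refine pow_le_pow_left₀ (norm_nonneg _) ?_ _
      rw [Real.norm_eq_abs, Real.norm_eq_abs]
      exact abs_max_le_max_abs_abs.trans (by simp)
    refine this.trans_isLittleO ?_
    simpa using Asymptotics.isLittleO_pow_pow (𝕜 := ℝ) (show 1 < n + 2 by omega)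
  · rw [max_eq_left h.le]
    have : (fun z : ℝ => max z 0 ^ (n + 2)) =ᶠ[𝓝 x] fun z => z ^ (n + 2) := by
      filter_upwards [Ioi_mem_nhds h] with z hz
      rw [max_eq_left (le_of_lt hz)]
    have := (hasDerivAt_pow (n + 2) x).congr_of_eventuallyEq this
    simpa using this

theorem hasDerivAt_posPart_sub (n : ℕ) (s x : ℝ) :
    HasDerivAt (fun z : ℝ => max (z - s) 0 ^ (n + 2)) ((n + 2) * max (x - s) 0 ^ (n + 1)) x := by
  have h := (hasDerivAt_posPart_pow n (x - s)).comp x ((hasDerivAt_id x).sub_const s)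
  exact h.congr_deriv (by simp)

theorem hasDerivAt_posPart_sub' (n : ℕ) (s x : ℝ) :
    HasDerivAt (fun z : ℝ => max (s - z) 0 ^ (n + 2)) (-((n + 2) * max (s - x) 0 ^ (n + 1))) x := by
  have h := (hasDerivAt_posPart_pow n (s - x)).comp x ((hasDerivAt_id x).const_sub s)
  exact h.congr_deriv (by simp)

theorem HasDerivAt.inner_const_left {F : ℝ → H1} {F' : H1} {x : ℝ} (c : H1)
    (h : HasDerivAt F F' x) : HasDerivAt (fun y => ⟪c, F y⟫) ⟪c, F'⟫ x :=
  ((innerSL ℝ c).hasFDerivAt.comp_hasDerivAt x h)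

theorem HasDerivAt.inner_const_right {F : ℝ → H1} {F' : H1} {x : ℝ} (c : H1)
    (h : HasDerivAt F F' x) : HasDerivAt (fun y => ⟪F y, c⟫) ⟪F', c⟫ x := by
  simpa only [real_inner_comm c] using HasDerivAt.inner_const_left c h

theorem min_eq_sub_posPart (x s : ℝ) : min x s = x - max (x - s) 0 := by
  rcases le_total x s with h | h <;> simp [h]

theorem inner_J_Psi {t s : ℝ} (ht : t ∈ I01) (hs : s ∈ I01) :
    ⟪J t, Psi s⟫ = s + t * s + max (t - s) 0 ^ 2 / 2 - t ^ 2 / 2 := by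
  refine eq_of_hasDerivAt_eq (f := fun s => ⟪J t, Psi s⟫)
    (g := fun s => s + t * s + max (t - s) 0 ^ 2 / 2 - t ^ 2 / 2)
    (fun y => HasDerivAt.inner_const_left _ (hasDerivAt_Psi y))
    (fun y => ((((hasDerivAt_id y).add ((hasDerivAt_id y).const_mul t)).add
      ((hasDerivAt_posPart_sub' 0 t y).div_const 2)).sub_const (t ^ 2 / 2)))
    (fun y hy => ?_) ?_ hs
  · rw [inner_J_J ht hy, min_eq_sub_posPart]; push_cast; ring
  · simp [Psi_zero, ht.1]

theorem inner_Psi_Psi {t s : ℝ} (ht : t ∈ I01) (hs : s ∈ I01) :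
    ⟪Psi t, Psi s⟫ = t * s + t ^ 2 * s / 2 + max (t - s) 0 ^ 3 / 6 - t ^ 3 / 6 := by
  refine eq_of_hasDerivAt_eq (f := fun t => ⟪Psi t, Psi s⟫)
    (g := fun t => t * s + t ^ 2 * s / 2 + max (t - s) 0 ^ 3 / 6 - t ^ 3 / 6)
    (fun y => HasDerivAt.inner_const_right _ (hasDerivAt_Psi y))
    (fun y => (((((hasDerivAt_id y).mul_const s).add
      (((hasDerivAt_pow 2 y).mul_const s).div_const 2)).add
      ((hasDerivAt_posPart_sub 1 s y).div_const 6)).sub ((hasDerivAt_pow 3 y).div_const 6)))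
    (fun y hy => ?_) ?_ ht
  · rw [inner_J_Psi hy hs]; push_cast; ring
  · simp [Psi_zero, hs.1]

theorem R2_eq_inner {t s : ℝ} (ht : t ∈ I01) (hs : s ∈ I01) : R2 t s = ⟪Psi t, Psi s⟫ := by
  rw [inner_Psi_Psi ht hs, R2]
  split_ifs with h
  · rw [max_eq_left (by linarith)]; ring
  · rw [max_eq_right (by linarith)]; ring

theorem inner_J_zero_Th2 {x : ℝ} (hx : x ∈ I01) : ⟪J 0, Th2 x⟫ = 0 := by
  have h0 : (0 : ℝ) ∈ I01 := by simp
  rw [Th2, inner_sub_right, inner_J_J h0 hx, inner_J_J h0 h0]; simp [hx.1]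

theorem inner_J_zero_Th1 {x : ℝ} (hx : x ∈ I01) : ⟪J 0, Th1 x⟫ = 1 := by
  refine eq_of_hasDerivAt_eq (f := fun s => ⟪J 0, Th1 s⟫) (g := fun _ => 1)
    (fun y => HasDerivAt.inner_const_left _ (hasDerivAt_Th1 y))
    (fun y => hasDerivAt_const y 1) (fun y hy => inner_J_zero_Th2 hy) ?_ hx
  have h0 : (0 : ℝ) ∈ I01 := by simp
  simp only [Th1_zero]; rw [inner_J_J h0 h0]; simp

theorem inner_J_zero_Th0 {x : ℝ} (hx : x ∈ I01) : ⟪J 0, Th0 x⟫ = x := by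
  refine eq_of_hasDerivAt_eq (f := fun s => ⟪J 0, Th0 s⟫) (g := fun x => x)
    (fun y => HasDerivAt.inner_const_left _ (hasDerivAt_Th0 y))
    (fun y => hasDerivAt_id y) (fun y hy => inner_J_zero_Th1 hy) ?_ hx
  simp [Th0_zero]

/-- Start of a chain: the following inner products come from this one by integrating twice in `s`
and then twice in `x`. -/
theorem inner_Th2_Th2 {x s : ℝ} (hx : x ∈ I01) (hs : s ∈ I01) :
    ⟪Th2 x, Th2 s⟫ = x - max (x - s) 0 := by
  have h0 : (0 : ℝ) ∈ I01 := by simp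
  rw [← min_eq_sub_posPart]
  simp only [Th2, inner_sub_right, inner_sub_left, inner_J_J hx hs, inner_J_J h0 hs,
    inner_J_J hx h0, inner_J_J h0 h0, min_eq_left hs.1, min_eq_right hx.1]
  simp

theorem inner_Th2_Th1 {x s : ℝ} (hx : x ∈ I01) (hs : s ∈ I01) :
    ⟪Th2 x, Th1 s⟫ = x * s + max (x - s) 0 ^ 2 / 2 - x ^ 2 / 2 := by
  refine eq_of_hasDerivAt_eq (f := fun s => ⟪Th2 x, Th1 s⟫)
    (g := fun s => x * s + max (x - s) 0 ^ 2 / 2 - x ^ 2 / 2)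
    (fun y => HasDerivAt.inner_const_left _ (hasDerivAt_Th1 y))
    (fun y => (((hasDerivAt_id y).const_mul x).add
      ((hasDerivAt_posPart_sub' 0 x y).div_const 2)).sub_const (x ^ 2 / 2))
    (fun y hy => ?_) ?_ hs
  · rw [inner_Th2_Th2 hx hy]; push_cast; ring
  · simp only [Th1_zero]; rw [real_inner_comm, inner_J_zero_Th2 hx]; simp [hx.1]

theorem inner_Th2_Th0 {x s : ℝ} (hx : x ∈ I01) (hs : s ∈ I01) :
    ⟪Th2 x, Th0 s⟫ = x * s ^ 2 / 2 - max (x - s) 0 ^ 3 / 6 + x ^ 3 / 6 - x ^ 2 / 2 * s := by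
  refine eq_of_hasDerivAt_eq (f := fun s => ⟪Th2 x, Th0 s⟫)
    (g := fun s => x * s ^ 2 / 2 - max (x - s) 0 ^ 3 / 6 + x ^ 3 / 6 - x ^ 2 / 2 * s)
    (fun y => HasDerivAt.inner_const_left _ (hasDerivAt_Th0 y))
    (fun y => (((((hasDerivAt_pow 2 y).const_mul x).div_const 2).sub
      ((hasDerivAt_posPart_sub' 1 x y).div_const 6)).add_const (x ^ 3 / 6)).sub
      ((hasDerivAt_id y).const_mul (x ^ 2 / 2)))
    (fun y hy => ?_) ?_ hs
  · rw [inner_Th2_Th1 hx hy]; push_cast; ring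
  · simp [Th0_zero, hx.1]

theorem inner_Th1_Th0 {x s : ℝ} (hx : x ∈ I01) (hs : s ∈ I01) :
    ⟪Th1 x, Th0 s⟫ =
      s + x ^ 2 * (s ^ 2 / 4) - max (x - s) 0 ^ 4 / 24 + x ^ 4 / 24 - x ^ 3 * (s / 6) := by
  refine eq_of_hasDerivAt_eq (f := fun x => ⟪Th1 x, Th0 s⟫)
    (g := fun x =>
      s + x ^ 2 * (s ^ 2 / 4) - max (x - s) 0 ^ 4 / 24 + x ^ 4 / 24 - x ^ 3 * (s / 6))
    (fun y => HasDerivAt.inner_const_right _ (hasDerivAt_Th1 y))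
    (fun y => (((((hasDerivAt_pow 2 y).mul_const (s ^ 2 / 4)).const_add s).sub
      ((hasDerivAt_posPart_sub 2 s y).div_const 24)).add
      ((hasDerivAt_pow 4 y).div_const 24)).sub ((hasDerivAt_pow 3 y).mul_const (s / 6)))
    (fun y hy => ?_) ?_ hx
  · rw [inner_Th2_Th0 hy hs]; push_cast; ring
  · simp only [Th1_zero]; rw [inner_J_zero_Th0 hs]; simp [hs.1]

theorem inner_Th0_Th0 {x s : ℝ} (hx : x ∈ I01) (hs : s ∈ I01) :
    ⟪Th0 x, Th0 s⟫ =
      x * s + x ^ 3 * (s ^ 2 / 12) - max (x - s) 0 ^ 5 / 120 + x ^ 5 / 120 - x ^ 4 * (s / 24) := by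
  refine eq_of_hasDerivAt_eq (f := fun x => ⟪Th0 x, Th0 s⟫)
    (g := fun x =>
      x * s + x ^ 3 * (s ^ 2 / 12) - max (x - s) 0 ^ 5 / 120 + x ^ 5 / 120 - x ^ 4 * (s / 24))
    (fun y => HasDerivAt.inner_const_right _ (hasDerivAt_Th0 y))
    (fun y => (((((hasDerivAt_id y).mul_const s).add
      ((hasDerivAt_pow 3 y).mul_const (s ^ 2 / 12))).sub
      ((hasDerivAt_posPart_sub 3 s y).div_const 120)).add
      ((hasDerivAt_pow 5 y).div_const 120)).sub ((hasDerivAt_pow 4 y).mul_const (s / 24)))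
    (fun y hy => ?_) ?_ hx
  · rw [inner_Th1_Th0 hy hs]; push_cast; ring
  · simp [Th0_zero, hs.1]

theorem R3_eq_inner {x s : ℝ} (hx : x ∈ I01) (hs : s ∈ I01) : R3 x s = ⟪Phi x, Phi s⟫ := by
  have h1 : (1 : ℝ) ∈ I01 := by simp
  simp only [Phi, inner_sub_left, inner_sub_right, inner_smul_left, inner_smul_right,
    inner_Th0_Th0 hx hs, inner_Th0_Th0 h1 hs, inner_Th0_Th0 hx h1, inner_Th0_Th0 h1 h1,
    conj_trivial]
  rw [max_eq_left (by linarith [hs.2] : (0 : ℝ) ≤ 1 - s),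
    max_eq_right (by linarith [hx.2] : x - 1 ≤ 0), sub_self, max_self, R3]
  split_ifs with h
  · rw [max_eq_left (by linarith)]; ring
  · rw [max_eq_right (by linarith)]; ring

theorem K_eq_inner {x t ξ η : ℝ} (hx : x ∈ I01) (ht : t ∈ I01) (hξ : ξ ∈ I01) (hη : η ∈ I01) :
    K x t ξ η = ⟪tens (Phi ξ) (Psi η), tens (Phi x) (Psi t)⟫ := by
  rw [K, inner_tens, R3_eq_inner hx hξ, R2_eq_inner ht hη, real_inner_comm, real_inner_comm (Psi t)]

/-! ### Lebesgue integrals behind the inner products -/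

theorem ind_congr {s t : Set ℝ} (h : s = t) (hs : MeasurableSet s) (ht : MeasurableSet t) :
    ind s hs = ind t ht := by subst h; rfl

theorem J_zero_eq : J 0 = ind {0} (measurableSet_singleton 0) :=
  ind_congr (by simp) _ _

/-- Subtracting `J 0` removes the atom, so pairing with `Th2 x` is integration against Lebesgue
measure, whereas pairing with `J 0` is evaluation at the atom. -/
theorem Th2_eq_ind {x : ℝ} (hx : x ∈ I01) : Th2 x = ind (Ioc 0 x) measurableSet_Ioc := by
  have h0 : ∀ {s : Set ℝ} (hs : MeasurableSet s), ind s hs =ᵐ[refMeasure] s.indicator fun _ => 1 :=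
    fun hs => indicatorConstLp_coeFn
  have hJ : J x = ind (Icc 0 x) measurableSet_Icc := ind_congr (by rw [abs_of_nonneg hx.1]) _ _
  rw [Th2, hJ, J_zero_eq]
  refine Lp.ext ?_
  filter_upwards [Lp.coeFn_sub (ind (Icc 0 x) measurableSet_Icc) (ind {0} (measurableSet_singleton 0)),
    h0 (measurableSet_Icc (a := (0 : ℝ)) (b := x)), h0 (measurableSet_singleton (0 : ℝ)),
    h0 (measurableSet_Ioc (a := (0 : ℝ)) (b := x))] with z h1 h2 h3 h4
  rw [h1, Pi.sub_apply, h2, h3, h4]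
  rcases lt_trichotomy z 0 with h | h | h
  · simp [indicator, h.not_ge, h.ne, h.not_gt]
  · simp [indicator, h, hx.1]
  · simp [indicator, h, h.le, h.ne']

theorem refMeasure_restrict_Ioc {x : ℝ} (hx : x ∈ I01) :
    refMeasure.restrict (Ioc 0 x) = volume.restrict (Ioc 0 x) := by
  rw [refMeasure, Measure.restrict_add, Measure.restrict_restrict measurableSet_Ioc,
    inter_eq_left.2 (Ioc_subset_Icc_self.trans (Icc_subset_Icc_right hx.2)),
    restrict_dirac' measurableSet_Ioc]
  simp

theorem refMeasure_restrict_zero : refMeasure.restrict {0} = Measure.dirac 0 := by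
  rw [refMeasure, Measure.restrict_add,
    restrict_dirac' (measurableSet_singleton _), if_pos (mem_singleton _),
    Measure.restrict_eq_zero.2, add_zero]
  exact le_antisymm ((Measure.restrict_apply_le _ _).trans (by simp)) (zero_le)

/-- The value of the class `c` at the corner is meaningful because the corner has positive mass. -/
theorem inner_tens_J_zero (c : H2) : ⟪c, tens (J 0) (J 0)⟫ = c (0, 0) := by
  rw [J_zero_eq, inner_tens_ind, ← Measure.prod_restrict, refMeasure_restrict_zero,
    Measure.dirac_prod_dirac, integral_dirac]

theorem inner_tens_Th2_J_zero (c : H2) {x : ℝ} (hx : x ∈ I01) :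
    ⟪c, tens (Th2 x) (J 0)⟫ = ∫ r in (0 : ℝ)..x, c (r, 0) := by
  rw [J_zero_eq, Th2_eq_ind hx, inner_tens_ind, ← Measure.prod_restrict, refMeasure_restrict_zero,
    refMeasure_restrict_Ioc hx, Measure.prod_dirac, intervalIntegral.integral_of_le hx.1,
    integral_map measurable_prodMk_right.aemeasurable
      (Lp.stronglyMeasurable c).aestronglyMeasurable]

theorem inner_tens_J_zero_Th2 (c : H2) {x : ℝ} (hx : x ∈ I01) :
    ⟪c, tens (J 0) (Th2 x)⟫ = ∫ r in (0 : ℝ)..x, c (0, r) := by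
  rw [J_zero_eq, Th2_eq_ind hx, inner_tens_ind, ← Measure.prod_restrict, refMeasure_restrict_zero,
    refMeasure_restrict_Ioc hx, Measure.dirac_prod, intervalIntegral.integral_of_le hx.1,
    integral_map measurable_prodMk_left.aemeasurable
      (Lp.stronglyMeasurable c).aestronglyMeasurable]

theorem inner_tens_Th2_Th2 (c : H2) {x t : ℝ} (hx : x ∈ I01) (ht : t ∈ I01) :
    ⟪c, tens (Th2 x) (Th2 t)⟫ = ∫ z in Icc 0 x ×ˢ Icc 0 t, c z := by
  rw [Th2_eq_ind hx, Th2_eq_ind ht, inner_tens_ind, ← Measure.prod_restrict,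
    refMeasure_restrict_Ioc hx, refMeasure_restrict_Ioc ht,
    Measure.restrict_congr_set (Ioc_ae_eq_Icc (a := (0 : ℝ)) (b := x)),
    Measure.restrict_congr_set (Ioc_ae_eq_Icc (a := (0 : ℝ)) (b := t)), Measure.prod_restrict,
    Measure.volume_eq_prod]

/-- Corner, left edge, bottom edge and square carry the four surviving pieces of the inner product.
-/
theorem refMeasure_prod : refMeasure.prod refMeasure =
    Measure.dirac (0, 0) + (volume.restrict I01).map (Prod.mk 0)
      + (volume.restrict I01).map (fun x => (x, 0)) + volume.restrict D := by
  rw [refMeasure, Measure.add_prod, Measure.prod_add, Measure.prod_add, Measure.dirac_prod_dirac,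
    Measure.dirac_prod, Measure.prod_dirac, Measure.prod_restrict, ← Measure.volume_eq_prod]
  simp only [add_assoc]

theorem restrict_D_le : volume.restrict D ≤ refMeasure.prod refMeasure := by
  rw [refMeasure_prod]; exact Measure.le_add_left le_rfl

theorem map_left_le : (volume.restrict I01).map (Prod.mk 0) ≤ refMeasure.prod refMeasure := by
  rw [refMeasure_prod]
  exact Measure.le_add_right (Measure.le_add_right (Measure.le_add_left le_rfl))

theorem map_right_le :
    (volume.restrict I01).map (fun x => (x, 0)) ≤ refMeasure.prod refMeasure := by
  rw [refMeasure_prod]; exact Measure.le_add_right (Measure.le_add_left le_rfl)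

theorem memLp_D (c : H2) : MemLp c 2 (volume.restrict D) := (Lp.memLp c).mono_measure restrict_D_le

theorem memLp_left (c : H2) : MemLp (fun r => c (0, r)) 2 (volume.restrict I01) :=
  (memLp_map_measure_iff (Lp.stronglyMeasurable c).aestronglyMeasurable
    measurable_prodMk_left.aemeasurable).1 ((Lp.memLp c).mono_measure map_left_le)

theorem memLp_right (c : H2) : MemLp (fun r => c (r, 0)) 2 (volume.restrict I01) :=
  (memLp_map_measure_iff (Lp.stronglyMeasurable c).aestronglyMeasurable
    measurable_prodMk_right.aemeasurable).1 ((Lp.memLp c).mono_measure map_right_le)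

theorem intervalIntegrable_of_memLp {a : ℝ → ℝ} (h : MemLp a 2 (volume.restrict I01)) :
    IntervalIntegrable a volume 0 1 := by
  rw [intervalIntegrable_iff_integrableOn_Icc_of_le zero_le_one]
  exact h.integrable one_le_two

theorem integral_refMeasure_prod {g : ℝ × ℝ → ℝ} (hm : StronglyMeasurable g)
    (hint : Integrable g (refMeasure.prod refMeasure)) :
    ∫ z, g z ∂refMeasure.prod refMeasure = g (0, 0) + (∫ s in (0 : ℝ)..1, g (0, s))
      + (∫ r in (0 : ℝ)..1, g (r, 0)) + ∫ z in D, g z := by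
  rw [refMeasure_prod] at hint ⊢
  have h1 := hint.left_of_add_measure
  have h2 := h1.left_of_add_measure
  rw [integral_add_measure h1 hint.right_of_add_measure,
    integral_add_measure h2 h1.right_of_add_measure,
    integral_add_measure h2.left_of_add_measure h2.right_of_add_measure, integral_dirac,
    integral_map measurable_prodMk_left.aemeasurable hm.aestronglyMeasurable,
    integral_map measurable_prodMk_right.aemeasurable hm.aestronglyMeasurable,
    intervalIntegral.integral_of_le zero_le_one, intervalIntegral.integral_of_le zero_le_one,
    integral_Icc_eq_integral_Ioc, integral_Icc_eq_integral_Ioc]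

theorem inner_eq_integrals (c c' : H2) :
    ⟪c, c'⟫ = c (0, 0) * c' (0, 0) + (∫ s in (0 : ℝ)..1, c (0, s) * c' (0, s))
      + (∫ r in (0 : ℝ)..1, c (r, 0) * c' (r, 0)) + ∫ z in D, c z * c' z := by
  have hint : Integrable (fun z => c z * c' z) (refMeasure.prod refMeasure) := by
    refine (L2.integrable_inner (𝕜 := ℝ) c' c).congr (Eventually.of_forall fun z => ?_)
    simp
  have hm : StronglyMeasurable (fun z => c z * c' z) :=
    (Lp.stronglyMeasurable c).mul (Lp.stronglyMeasurable c')
  rw [L2.inner_def, ← integral_refMeasure_prod hm hint]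
  exact integral_congr_ae (Eventually.of_forall fun z => by simp [mul_comm])

/-! ### Uniqueness of the mixed density -/

theorem isCountablySpanning_range_Iic : IsCountablySpanning (range (Iic : ℝ → Set ℝ)) :=
  ⟨fun n : ℕ => Iic (n : ℝ), fun n => mem_range_self _, by
    rw [iUnion_eq_univ_iff]; exact fun x => (exists_nat_ge x).imp fun n h => h⟩

/-- The products of lower rays form a π-system generating the Borel sets, and each meets `D` in a
rectangle anchored at the origin or not at all. Hence the arbitrary choice in `mixedDeriv` is
harmless. -/
theorem isMixedDensity_unique {v : ℝ → ℝ → ℝ} {c c' : ℝ × ℝ → ℝ} (h : IsMixedDensity v c)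
    (h' : IsMixedDensity v c') : c =ᵐ[volume.restrict D] c' := by
  have hc : Integrable c (volume.restrict D) := h.1
  have hc' : Integrable c' (volume.restrict D) := h'.1
  refine Integrable.ae_eq_of_withDensityᵥ_eq hc hc' ?_
  have hb : MeasurableSpace.generateFrom (range (Iic : ℝ → Set ℝ)) = (inferInstance : MeasurableSpace ℝ) := by
    rw [← borel_eq_generateFrom_Iic]; exact (BorelSpace.measurable_eq (α := ℝ)).symm
  have key : ∀ s ⊆ I01, ∀ t ⊆ I01, ((s = ∅ ∨ ∃ a ∈ I01, s = Icc 0 a) ∧ (t = ∅ ∨ ∃ a ∈ I01, t = Icc 0 a)) →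
      ∫ z in s ×ˢ t, c z = ∫ z in s ×ˢ t, c' z := by
    rintro s - t - ⟨hs, ht⟩
    rcases hs with rfl | ⟨a, ha, rfl⟩
    · simp
    rcases ht with rfl | ⟨b, hb, rfl⟩
    · simp
    rw [← h.2 a ha b hb, ← h'.2 a ha b hb]
  have cut : ∀ a : ℝ, Iic a ∩ I01 = ∅ ∨ ∃ b ∈ I01, Iic a ∩ I01 = Icc 0 b := by
    intro a
    rcases lt_or_ge a 0 with ha | ha
    · left; ext z; simp only [mem_inter_iff, mem_Iic, mem_Icc, mem_empty_iff_false, iff_false]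
      rintro ⟨h1, h2, _⟩; linarith
    · right
      refine ⟨min a 1, ⟨by simp [ha], by simp⟩, ?_⟩
      ext z; simp only [mem_inter_iff, mem_Iic, mem_Icc, le_min_iff]; tauto
  refine VectorMeasure.ext_of_generateFrom (image2 (· ×ˢ ·) (range Iic) (range Iic)) ?_
    (generateFrom_eq_prod hb hb isCountablySpanning_range_Iic isCountablySpanning_range_Iic).symm
    (isPiSystem_Iic.prod isPiSystem_Iic) ?_
  · rintro _ ⟨_, ⟨a, rfl⟩, _, ⟨b, rfl⟩, rfl⟩
    have hm : MeasurableSet (Iic a ×ˢ Iic b) := measurableSet_Iic.prod measurableSet_Iic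
    simp only
    rw [withDensityᵥ_apply hc hm, withDensityᵥ_apply hc' hm, Measure.restrict_restrict hm,
      prod_inter_prod]
    exact key _ inter_subset_right _ inter_subset_right ⟨cut a, cut b⟩
  · rw [withDensityᵥ_apply hc MeasurableSet.univ, withDensityᵥ_apply hc' MeasurableSet.univ,
      Measure.restrict_univ]
    exact key _ subset_rfl _ subset_rfl ⟨Or.inr ⟨1, by simp, rfl⟩, Or.inr ⟨1, by simp, rfl⟩⟩

theorem mixedDeriv_ae_eq {v : ℝ → ℝ → ℝ} {c : ℝ × ℝ → ℝ} (h : IsMixedDensity v c) :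
    mixedDeriv v =ᵐ[volume.restrict D] c := by
  have hex : ∃ c, IsMixedDensity v c := ⟨c, h⟩
  rw [mixedDeriv, dif_pos hex]
  exact isMixedDensity_unique hex.choose_spec h

/-! ### One-sided derivatives -/

theorem d1_eq {g h : ℝ → ℝ} {h' x : ℝ} (hgh : ∀ x ∈ I01, g x = h x) (hd : HasDerivAt h h' x)
    (hx : x ∈ I01) : d1 g x = h' := by
  have : HasDerivWithinAt g h' I01 x := hd.hasDerivWithinAt.congr hgh (hgh x hx)
  exact this.derivWithin (uniqueDiffOn_Icc zero_lt_one x hx)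

theorem d1_eq_zero {g : ℝ → ℝ} {x : ℝ} (hg : ∀ x ∈ I01, g x = 0) (hx : x ∈ I01) : d1 g x = 0 :=
  d1_eq hg (hasDerivAt_const x 0) hx

/-- Lebesgue differentiation; it recovers the edge coordinates as top-order derivatives. -/
theorem ae_d1_eq {h a : ℝ → ℝ} {k : ℝ} (ha : IntervalIntegrable a volume 0 1)
    (hh : ∀ x ∈ I01, h x = k + ∫ r in (0 : ℝ)..x, a r) :
    ∀ᵐ x ∂volume.restrict I01, d1 h x = a x := by
  rw [ae_restrict_iff' measurableSet_Icc]
  filter_upwards [ha.ae_hasDerivAt_integral] with x hx hxI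
  rw [uIcc_of_le zero_le_one] at hx
  exact d1_eq hh ((hx hxI 0 (by simp)).const_add k) hxI

theorem absolutelyContinuous_of_eq_integral {h a : ℝ → ℝ} {k : ℝ}
    (ha : IntervalIntegrable a volume 0 1)
    (hh : ∀ x ∈ I01, h x = k + ∫ r in (0 : ℝ)..x, a r) :
    AbsolutelyContinuousOnInterval h 0 1 := by
  have h1 := ha.absolutelyContinuousOnInterval_intervalIntegral (c := 0) (by simp)
  rw [absolutelyContinuousOnInterval_iff] at h1 ⊢
  intro ε hε
  obtain ⟨δ, hδ, H⟩ := h1 ε hε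
  refine ⟨δ, hδ, fun E hE hs => ?_⟩
  refine lt_of_eq_of_lt (Finset.sum_congr rfl fun i hi => ?_) (H E hE hs)
  have := hE.1 i hi
  rw [uIcc_of_le zero_le_one] at this
  rw [hh _ this.1, hh _ this.2, dist_add_left]

/-! ### Functions represented by an element of the coordinate space -/

/-- On `D`, the function `y` is `(ξ,η) ↦ ⟪c, F(ξ) ⊗ G(η)⟫`. -/
def Repr (y : ℝ → ℝ → ℝ) (c : H2) (F G : ℝ → H1) : Prop :=
  ∀ ξ ∈ I01, ∀ η ∈ I01, y ξ η = ⟪c, tens (F ξ) (G η)⟫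

theorem hasDerivAt_inner_tens_left (c : H2) (g : H1) {F : ℝ → H1} {F' : H1} {x : ℝ}
    (h : HasDerivAt F F' x) : HasDerivAt (fun ξ => ⟪c, tens (F ξ) g⟫) ⟪c, tens F' g⟫ x :=
  ((innerSL ℝ c).comp (tens.flip g)).hasFDerivAt.comp_hasDerivAt x h

theorem hasDerivAt_inner_tens_right (c : H2) (f : H1) {G : ℝ → H1} {G' : H1} {x : ℝ}
    (h : HasDerivAt G G' x) : HasDerivAt (fun η => ⟪c, tens f (G η)⟫) ⟪c, tens f G'⟫ x :=
  ((innerSL ℝ c).comp (tens f)).hasFDerivAt.comp_hasDerivAt x h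

section Repr

variable {y : ℝ → ℝ → ℝ} {c : H2} {F G F' G' : ℝ → H1}

theorem Repr.pXi (h : Repr y c F G) (hF : ∀ x, HasDerivAt F (F' x) x) :
    Repr (pXi y) c F' G := fun ξ hξ η hη =>
  d1_eq (fun s hs => h s hs η hη) (hasDerivAt_inner_tens_left c (G η) (hF ξ)) hξ

theorem Repr.pEta (h : Repr y c F G) (hG : ∀ x, HasDerivAt G (G' x) x) :
    Repr (pEta y) c F G' := fun ξ hξ η hη =>
  d1_eq (fun s hs => h ξ hξ s hs) (hasDerivAt_inner_tens_right c (F ξ) (hG η)) hη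

theorem Repr.differentiableOn_xi (h : Repr y c F G) (hF : ∀ x, HasDerivAt F (F' x) x) :
    ∀ η ∈ I01, DifferentiableOn ℝ (fun s => y s η) I01 := fun η hη ξ hξ =>
  ((hasDerivAt_inner_tens_left c (G η) (hF ξ)).differentiableAt.differentiableWithinAt).congr
    (fun s hs => h s hs η hη) (h ξ hξ η hη)

theorem Repr.differentiableOn_eta (h : Repr y c F G) (hG : ∀ x, HasDerivAt G (G' x) x) :
    ∀ ξ ∈ I01, DifferentiableOn ℝ (fun s => y ξ s) I01 := fun ξ hξ η hη =>
  ((hasDerivAt_inner_tens_right c (F ξ) (hG η)).differentiableAt.differentiableWithinAt).congr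
    (fun s hs => h ξ hξ s hs) (h ξ hξ η hη)

end Repr

instance : IsFiniteMeasure (volume.restrict D) :=
  ⟨by rw [Measure.restrict_apply_univ]; exact (isCompact_Icc.prod isCompact_Icc).measure_lt_top⟩

theorem integrable_mul_fst (c : H2) (f : H1) :
    Integrable (fun z => c z * f z.1) (refMeasure.prod refMeasure) :=
  (Lp.memLp c).integrable_mul ((Lp.memLp f).comp_fst refMeasure)

theorem inner_tens_ind_right (c : H2) (f : H1) (s : Set ℝ) (hs : MeasurableSet s) :
    ⟪c, tens f (ind s hs)⟫ = ∫ r in s, (∫ x, c (x, r) * f x ∂refMeasure) ∂refMeasure := by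
  have h1 : ⟪c, tens f (ind s hs)⟫
      = ∫ z in univ ×ˢ s, c z * f z.1 ∂refMeasure.prod refMeasure := by
    rw [L2.inner_def, ← integral_indicator (MeasurableSet.univ.prod hs)]
    refine integral_congr_ae ?_
    filter_upwards [coeFn_tensFun f (ind s hs),
      ae_snd (indicatorConstLp_coeFn (p := 2) (hs := hs) (hμs := measure_ne_top refMeasure s)
        (c := (1 : ℝ)))] with z h1 h2
    rw [tens_apply, h1]
    unfold ind
    rw [h2]
    by_cases h : z.2 ∈ s <;> simp [indicator, h, mul_comm]
  have h2 : (refMeasure.prod refMeasure).restrict (univ ×ˢ s)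
      = refMeasure.prod (refMeasure.restrict s) := by
    rw [← Measure.prod_restrict, Measure.restrict_univ]
  have h3 := (integrable_mul_fst c f).restrict (s := univ ×ˢ s)
  rw [h2] at h3
  rw [h1, h2, integral_prod_symm _ h3]

/-- Serves the edge ξ = 0, where `Phi2 0` is a multiple of `Th0 1` and not an indicator. Fubini
gives the density as `c` integrated against `f` in the first variable. -/
theorem exists_density_inner_tens (c : H2) (f : H1) : ∃ b : ℝ → ℝ,
    IntervalIntegrable b volume 0 1 ∧
      ∀ η ∈ I01, ⟪c, tens f (Th2 η)⟫ = ∫ r in (0 : ℝ)..η, b r := by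
  refine ⟨fun r => ∫ x, c (x, r) * f x ∂refMeasure, ?_, fun η hη => ?_⟩
  · rw [intervalIntegrable_iff_integrableOn_Icc_of_le zero_le_one]
    refine (integrable_mul_fst c f).integral_prod_right.mono_measure ?_
    exact Measure.le_add_left le_rfl
  · rw [Th2_eq_ind hη, inner_tens_ind_right, refMeasure_restrict_Ioc hη,
      intervalIntegral.integral_of_le hη.1]

/-! ### Membership in W and the isometry. -/

section FullRepr

variable {y : ℝ → ℝ → ℝ} {c : H2}

theorem Repr.d21 (h : Repr y c Phi Psi) : Repr (d21 y) c Phi2 J :=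
  ((h.pEta hasDerivAt_Psi).pXi hasDerivAt_Phi).pXi hasDerivAt_Phi1

/-- In the rectangle increment the constant parts `2 • Th0 1` and `J 0` cancel, leaving `Th2 ξ ⊗ Th2
η`. -/
theorem Repr.isMixedDensity (h : Repr y c Phi Psi) : IsMixedDensity (FracBurgers.d21 y) c := by
  refine ⟨(memLp_D c).integrable one_le_two, fun ξ hξ η hη => ?_⟩
  have h0 : (0 : ℝ) ∈ I01 := by simp
  rw [h.d21 ξ hξ η hη, h.d21 ξ hξ 0 h0, h.d21 0 h0 η hη, h.d21 0 h0 0 h0,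
    ← inner_tens_Th2_Th2 c hξ hη]
  simp only [Phi2, Th2, map_sub, sub_apply, inner_sub_right]
  ring

theorem Repr.d21_right (h : Repr y c Phi Psi) : ∀ ξ ∈ I01,
    FracBurgers.d21 y ξ 0 = -⟪c, tens ((2 : ℝ) • Th0 1) (J 0)⟫ + ∫ r in (0 : ℝ)..ξ, c (r, 0) := by
  intro ξ hξ
  rw [h.d21 ξ hξ 0 (by simp), ← inner_tens_Th2_J_zero c hξ, Phi2, map_sub,
    sub_apply, inner_sub_right]
  ring

theorem J_eq_add_Th2 (x : ℝ) : J x = J 0 + Th2 x := by simp [Th2]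

theorem Repr.absContOnSquare (h : Repr y c Phi Psi) : AbsContOnSquare (FracBurgers.d21 y) := by
  refine ⟨absolutelyContinuous_of_eq_integral (intervalIntegrable_of_memLp (memLp_right c))
    h.d21_right, ?_, c, h.isMixedDensity⟩
  obtain ⟨b, hb, hbi⟩ := exists_density_inner_tens c (Phi2 0)
  refine absolutelyContinuous_of_eq_integral (k := ⟪c, tens (Phi2 0) (J 0)⟫) hb fun η hη => ?_
  rw [h.d21 0 (by simp) η hη, J_eq_add_Th2 η, map_add, inner_add_right, hbi η hη]

theorem Repr.ae_pXi_d21 (h : Repr y c Phi Psi) :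
    ∀ᵐ ξ ∂volume.restrict I01, FracBurgers.pXi (FracBurgers.d21 y) ξ 0 = c (ξ, 0) :=
  ae_d1_eq (intervalIntegrable_of_memLp (memLp_right c)) h.d21_right

theorem Repr.ae_pEta_pEta_pXi (h : Repr y c Phi Psi) :
    ∀ᵐ η ∂volume.restrict I01,
      FracBurgers.pEta (FracBurgers.pEta (FracBurgers.pXi y)) 0 η = c (0, η) := by
  refine ae_d1_eq (k := ⟪c, tens (J 0) (J 0)⟫) (intervalIntegrable_of_memLp (memLp_left c))
    fun η hη => ?_
  rw [(h.pXi hasDerivAt_Phi).pEta hasDerivAt_Psi 0 (by simp) η hη, Phi1_zero, J_eq_add_Th2 η,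
    map_add, inner_add_right, inner_tens_J_zero_Th2 c hη]

theorem Repr.memW (h : Repr y c Phi Psi) : MemW y where
  diff_eta := h.differentiableOn_eta hasDerivAt_Psi
  diff_xi_eta := (h.pEta hasDerivAt_Psi).differentiableOn_xi hasDerivAt_Phi
  diff_xi_xi_eta := ((h.pEta hasDerivAt_Psi).pXi hasDerivAt_Phi).differentiableOn_xi hasDerivAt_Phi1
  absCont := h.absContOnSquare
  memLp_mixed := (memLp_congr_ae (mixedDeriv_ae_eq h.isMixedDensity)).2 (memLp_D c)
  memLp_xi := (memLp_congr_ae h.ae_pXi_d21).2 (memLp_right c)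
  memLp_eta := (memLp_congr_ae h.ae_pEta_pEta_pXi).2 (memLp_left c)
  initial := fun ξ hξ => by rw [h ξ hξ 0 (by simp), Psi_zero]; simp
  boundary_left := fun η hη => by rw [h 0 (by simp) η hη, Phi_zero]; simp
  boundary_right := fun η hη => by rw [h 1 (by simp) η hη, Phi_one]; simp

theorem intervalIntegral_congr_ae_I01 {f g : ℝ → ℝ} (h : ∀ᵐ x ∂volume.restrict I01, f x = g x) :
    ∫ x in (0 : ℝ)..1, f x = ∫ x in (0 : ℝ)..1, g x := by
  rw [intervalIntegral.integral_of_le zero_le_one, intervalIntegral.integral_of_le zero_le_one,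
    ← integral_Icc_eq_integral_Ioc, ← integral_Icc_eq_integral_Ioc]
  exact integral_congr_ae h

theorem intervalIntegral_eq_zero_I01 {f : ℝ → ℝ} (h : ∀ x ∈ I01, f x = 0) :
    ∫ x in (0 : ℝ)..1, f x = 0 := by
  rw [intervalIntegral_congr_ae_I01 (g := fun _ => 0)
    ((ae_restrict_iff' measurableSet_Icc).2 (Eventually.of_forall h))]
  simp

/-- The side conditions kill `e1`, `e3` and `e4`. The left edge is `e2`, the corner and the bottom
edge are `e5`, the square is `e6`. -/
theorem innerW_eq {v : ℝ → ℝ → ℝ} {c' : H2} (h : Repr y c Phi Psi) (h' : Repr v c' Phi Psi) :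
    innerW y v = ⟪c, c'⟫ := by
  have h0 : (0 : ℝ) ∈ I01 := by simp
  have h1 : (1 : ℝ) ∈ I01 := by simp
  have e1 : ∫ η in (0 : ℝ)..1, pEta^[2] (pXi^[0] y) 0 η * pEta^[2] (pXi^[0] v) 0 η = 0 := by
    refine intervalIntegral_eq_zero_I01 fun η hη => ?_
    have : pEta^[2] (pXi^[0] y) 0 η = 0 := d1_eq_zero (fun t ht => by
      change pEta y 0 t = 0
      rw [h.pEta hasDerivAt_Psi 0 h0 t ht, Phi_zero]; simp) hη
    rw [this, zero_mul]
  have e2 : ∫ η in (0 : ℝ)..1, pEta^[2] (pXi^[1] y) 0 η * pEta^[2] (pXi^[1] v) 0 η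
      = ∫ s in (0 : ℝ)..1, c (0, s) * c' (0, s) := by
    refine intervalIntegral_congr_ae_I01 ?_
    filter_upwards [h.ae_pEta_pEta_pXi, h'.ae_pEta_pEta_pXi] with η a b
    exact congrArg₂ _ a b
  have e3 : ∫ η in (0 : ℝ)..1, pEta^[2] y 1 η * pEta^[2] v 1 η = 0 := by
    refine intervalIntegral_eq_zero_I01 fun η hη => ?_
    have : pEta^[2] y 1 η = 0 := d1_eq_zero (fun t ht => by
      rw [h.pEta hasDerivAt_Psi 1 h1 t ht, Phi_one]; simp) hη
    rw [this, zero_mul]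
  have e4 : innerW3 (fun ξ => pEta^[0] y ξ 0) (fun ξ => pEta^[0] v ξ 0) = 0 := by
    have hz : ∀ ξ ∈ I01, pEta^[0] y ξ 0 = 0 := h.memW.initial
    have hz1 : ∀ ξ ∈ I01, d1 (fun ξ => pEta^[0] y ξ 0) ξ = 0 := fun ξ hξ => d1_eq_zero hz hξ
    have hz2 : ∀ ξ ∈ I01, d1 (d1 (fun ξ => pEta^[0] y ξ 0)) ξ = 0 :=
      fun ξ hξ => d1_eq_zero hz1 hξ
    have hz3 : ∀ ξ ∈ I01, d1^[3] (fun ξ => pEta^[0] y ξ 0) ξ = 0 :=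
      fun ξ hξ => d1_eq_zero hz2 hξ
    rw [innerW3, intervalIntegral_eq_zero_I01 (fun ξ hξ => by rw [hz3 ξ hξ, zero_mul]),
      hz1 0 h0, hz 0 h0, hz 1 h1]
    ring
  have e5 : innerW3 (fun ξ => pEta^[1] y ξ 0) (fun ξ => pEta^[1] v ξ 0)
      = c (0, 0) * c' (0, 0) + ∫ r in (0 : ℝ)..1, c (r, 0) * c' (r, 0) := by
    have a0 : pEta^[1] y 0 0 = 0 :=
      (h.pEta hasDerivAt_Psi 0 h0 0 h0).trans (by rw [Phi_zero]; simp)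
    have a1 : pEta^[1] y 1 0 = 0 :=
      (h.pEta hasDerivAt_Psi 1 h1 0 h0).trans (by rw [Phi_one]; simp)
    have b : ∀ {w : ℝ → ℝ → ℝ} {k : H2}, Repr w k Phi Psi →
        d1 (fun ξ => pEta^[1] w ξ 0) 0 = k (0, 0) := fun {w k} hw =>
      ((hw.pEta hasDerivAt_Psi).pXi hasDerivAt_Phi 0 h0 0 h0).trans
        (by rw [Phi1_zero, inner_tens_J_zero])
    have e : ∫ ξ in (0 : ℝ)..1, d1^[3] (fun ξ => pEta^[1] y ξ 0) ξ
        * d1^[3] (fun ξ => pEta^[1] v ξ 0) ξ = ∫ r in (0 : ℝ)..1, c (r, 0) * c' (r, 0) := by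
      refine intervalIntegral_congr_ae_I01 ?_
      filter_upwards [h.ae_pXi_d21, h'.ae_pXi_d21] with η a b
      exact congrArg₂ _ a b
    rw [innerW3, e, a0, a1, b h, b h']
    ring
  have e6 : ∫ z in D, mixedDeriv (FracBurgers.d21 y) z * mixedDeriv (FracBurgers.d21 v) z
      = ∫ z in D, c z * c' z := by
    refine integral_congr_ae ?_
    filter_upwards [mixedDeriv_ae_eq h.isMixedDensity, mixedDeriv_ae_eq h'.isMixedDensity]
      with z a b
    rw [a, b]
  rw [innerW, Finset.sum_range_succ, Finset.sum_range_one, Finset.sum_range_succ,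
    Finset.sum_range_one, e1, e2, e3, e4, e5, e6, inner_eq_integrals]
  ring

theorem normW_eq (h : Repr y c Phi Psi) : normW y = ‖c‖ := by
  rw [normW, innerW_eq h h, real_inner_self_eq_norm_sq, Real.sqrt_sq (norm_nonneg _)]

theorem Repr.sub {v : ℝ → ℝ → ℝ} {c' : H2} {F G : ℝ → H1} (h : Repr y c F G)
    (h' : Repr v c' F G) : Repr (y - v) (c - c') F G := fun ξ hξ η hη => by
  rw [inner_sub_left, ← h ξ hξ η hη, ← h' ξ hξ η hη]; rfl

theorem Repr.sum_smul {ι : Type*} (s : Finset ι) (a : ι → ℝ) {w : ι → ℝ → ℝ → ℝ} {k : ι → H2}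
    {F G : ℝ → H1} (h : ∀ i ∈ s, Repr (w i) (k i) F G) :
    Repr (∑ i ∈ s, a i • w i) (∑ i ∈ s, a i • k i) F G := fun ξ hξ η hη => by
  rw [sum_inner, Finset.sum_apply, Finset.sum_apply]
  refine Finset.sum_congr rfl fun i hi => ?_
  rw [real_inner_smul_left, ← h i hi ξ hξ η hη]; rfl

end FullRepr

/-! ### The Caputo derivative and the operator `L` -/

theorem exists_norm_J_le : ∃ C, ∀ t, ‖J t‖ ≤ C := by
  refine ⟨1 * refMeasure.real univ ^ (1 / (2 : ENNReal).toReal), fun t => ?_⟩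
  unfold J ind
  refine norm_indicatorConstLp_le.trans ?_
  rw [norm_one]
  gcongr
  · simp
  · exact subset_univ _

/-- The Caputo derivative of order `α` of the representer `Psi`. -/
def PsiCap (α η : ℝ) : H1 :=
  if α = 1 then J η
  else (η ^ (1 - α) / Real.Gamma (1 - α)) •
    ∫ u in (0 : ℝ)..1, (1 - u) ^ (-α) • J (η * u)

theorem intervalIntegrable_weight {α : ℝ} (h : α < 1) (a b : ℝ) :
    IntervalIntegrable (fun u : ℝ => (b - u) ^ (-α)) volume a b := by
  have := (intervalIntegral.intervalIntegrable_rpow' (a := b - a) (b := 0) (r := -α)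
    (by linarith)).comp_sub_left b
  simpa using this

theorem intervalIntegrable_weight_smul {α : ℝ} (h : α < 1) (η : ℝ) :
    IntervalIntegrable (fun u : ℝ => (1 - u) ^ (-α) • J (η * u)) volume 0 1 :=
  (intervalIntegrable_weight h 0 1).smul_continuousOn
    (continuous_J.comp (continuous_const.mul continuous_id)).continuousOn

/-- After rescaling to [0,1] the singular weight no longer depends on η. Dominated convergence
applies because `J` is bounded and (1-u)^(-α) is integrable for α < 1. -/
theorem continuous_PsiCap {α : ℝ} (h1 : α ≤ 1) : Continuous (PsiCap α) := by
  by_cases h : α = 1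
  · have : PsiCap α = J := by ext1 η; simp [PsiCap, h]
    rw [this]; exact continuous_J
  have hlt : α < 1 := lt_of_le_of_ne h1 h
  have e : PsiCap α = fun η => (η ^ (1 - α) / Real.Gamma (1 - α)) •
      ∫ u in (0 : ℝ)..1, (1 - u) ^ (-α) • J (η * u) := by ext1 η; simp [PsiCap, h]
  rw [e]
  obtain ⟨C, hC⟩ := exists_norm_J_le
  have hc : Continuous fun η : ℝ => ∫ u in (0 : ℝ)..1, (1 - u) ^ (-α) • J (η * u) := by
    refine intervalIntegral.continuous_of_dominated_interval
      (bound := fun u => |(1 - u) ^ (-α)| * C)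
      (fun η => ?_) (fun η => ?_) ?_ ?_
    · exact (intervalIntegrable_weight_smul hlt η).def'.aestronglyMeasurable
    · refine Eventually.of_forall fun u _ => ?_
      rw [norm_smul, Real.norm_eq_abs]
      exact mul_le_mul_of_nonneg_left (hC _) (abs_nonneg _)
    · exact (intervalIntegrable_weight hlt 0 1).abs.mul_const C
    · refine Eventually.of_forall fun u _ => ?_
      exact (continuous_J.comp (continuous_id.mul continuous_const)).const_smul ((1 - u) ^ (-α))
  exact ((Real.continuous_rpow_const (by linarith)).div_const _).smul hc

theorem apply_PsiCap {α : ℝ} (hlt : α < 1) (l : H1 →L[ℝ] ℝ) {η : ℝ} (hη : 0 ≤ η) :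
    l (PsiCap α η) = 1 / Real.Gamma (1 - α) * ∫ r in (0 : ℝ)..η, l (J r) / (η - r) ^ α := by
  rw [PsiCap, if_neg hlt.ne, map_smul,
    ← l.intervalIntegral_comp_comm (intervalIntegrable_weight_smul hlt η), smul_eq_mul]
  rcases hη.eq_or_lt with rfl | hpos
  · rw [Real.zero_rpow (by linarith)]; simp
  have hs := intervalIntegral.smul_integral_comp_mul_left (a := 0) (b := 1)
    (fun r => l (J r) / (η - r) ^ α) η
  rw [mul_zero, mul_one] at hs
  rw [← hs, smul_eq_mul]
  have hi : ∫ x in (0 : ℝ)..1, l (J (η * x)) / (η - η * x) ^ α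
      = η ^ (-α) * ∫ u in (0 : ℝ)..1, l ((1 - u) ^ (-α) • J (η * u)) := by
    rw [← intervalIntegral.integral_const_mul]
    refine intervalIntegral.integral_congr fun u hu => ?_
    rw [uIcc_of_le zero_le_one] at hu
    simp only [map_smul, smul_eq_mul]
    rw [show η - η * u = η * (1 - u) by ring, Real.mul_rpow hpos.le (by linarith [hu.2]),
      Real.rpow_neg hpos.le, Real.rpow_neg (by linarith [hu.2])]
    field_simp
  rw [hi, sub_eq_add_neg, Real.rpow_add hpos, Real.rpow_one]
  ring

theorem Repr.caputo {y : ℝ → ℝ → ℝ} {c : H2} (h : Repr y c Phi Psi) {α : ℝ} (hα : α ≤ 1) :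
    Repr (fun ξ η => caputo α (fun t => y ξ t) η) c Phi (PsiCap α) := by
  intro ξ hξ η hη
  have hE := h.pEta hasDerivAt_Psi
  simp only [FracBurgers.caputo]
  split_ifs with h1
  · rw [PsiCap, if_pos h1]; exact hE ξ hξ η hη
  · refine Eq.trans ?_ (apply_PsiCap (lt_of_le_of_ne hα h1) ((innerSL ℝ c).comp (tens (Phi ξ)))
      hη.1).symm
    congr 1
    refine intervalIntegral.integral_congr fun r hr => ?_
    rw [uIcc_of_le hη.1] at hr
    have := hE ξ hξ r ⟨hr.1, hr.2.trans hη.2⟩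
    simp only [ContinuousLinearMap.comp_apply, innerSL_apply_apply]
    rw [← this]; rfl

/-- The representer of the functional `y ↦ L y (x,t)`. -/
def ell (α : ℝ) (k₁ k₂ k₃ : ℝ → ℝ → ℝ) (z : ℝ × ℝ) : H2 :=
  tens (Phi z.1) (PsiCap α z.2) + k₁ z.1 z.2 • tens (Phi2 z.1) (Psi z.2)
    + k₂ z.1 z.2 • tens (Phi z.1) (Psi z.2) + k₃ z.1 z.2 • tens (Phi1 z.1) (Psi z.2)

section Operator

variable {α : ℝ} {k₁ k₂ k₃ : ℝ → ℝ → ℝ}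

theorem inner_ell (c : H2) (z : ℝ × ℝ) : ⟪c, ell α k₁ k₂ k₃ z⟫ =
    ⟪c, tens (Phi z.1) (PsiCap α z.2)⟫ + k₁ z.1 z.2 * ⟪c, tens (Phi2 z.1) (Psi z.2)⟫
      + k₂ z.1 z.2 * ⟪c, tens (Phi z.1) (Psi z.2)⟫
      + k₃ z.1 z.2 * ⟪c, tens (Phi1 z.1) (Psi z.2)⟫ := by
  simp only [ell, inner_add_right, real_inner_smul_right]

theorem Repr.opL {y : ℝ → ℝ → ℝ} {c : H2} (h : Repr y c Phi Psi) (hα : α ≤ 1)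
    {ξ η : ℝ} (hξ : ξ ∈ I01) (hη : η ∈ I01) :
    opL α k₁ k₂ k₃ y ξ η = ⟪c, ell α k₁ k₂ k₃ (ξ, η)⟫ := by
  have h1 := h.pXi hasDerivAt_Phi
  rw [FracBurgers.opL, inner_ell, h ξ hξ η hη, h1 ξ hξ η hη,
    h1.pXi hasDerivAt_Phi1 ξ hξ η hη, ← h.caputo hα ξ hξ η hη]

/-- As a function of (x,t), the kernel has coordinates Φ(ξ) ⊗ Ψ(η); applying L pairs them with `ell
(p i)`. -/
theorem repr_psi (hα : α ≤ 1) {p : ℕ → ℝ × ℝ} (hp : ∀ i, p i ∈ D) (i : ℕ) :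
    Repr (psi α k₁ k₂ k₃ p i) (ell α k₁ k₂ k₃ (p i)) Phi Psi := by
  intro ξ hξ η hη
  have h : Repr (fun x t => K x t ξ η) (tens (Phi ξ) (Psi η)) Phi Psi :=
    fun x hx t ht => K_eq_inner hx ht hξ hη
  rw [psi, h.opL hα (hp i).1 (hp i).2, real_inner_comm]

theorem continuous_tens {F G : ℝ → H1} (hF : Continuous F) (hG : Continuous G) :
    Continuous fun z : ℝ × ℝ => tens (F z.1) (G z.2) :=
  tens.continuous₂.comp ((hF.comp continuous_fst).prodMk (hG.comp continuous_snd))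

theorem continuousOn_ell (hα : α ≤ 1) (hk₁ : ContinuousOn (Function.uncurry k₁) D)
    (hk₂ : ContinuousOn (Function.uncurry k₂) D) (hk₃ : ContinuousOn (Function.uncurry k₃) D) :
    ContinuousOn (ell α k₁ k₂ k₃) D :=
  (((continuous_tens continuous_Phi (continuous_PsiCap hα)).continuousOn.add
    (hk₁.smul (continuous_tens continuous_Phi2 continuous_Psi).continuousOn)).add
    (hk₂.smul (continuous_tens continuous_Phi continuous_Psi).continuousOn)).add
    (hk₃.smul (continuous_tens continuous_Phi1 continuous_Psi).continuousOn)

end Operator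

/-! ### Test functions in the second variable -/

/-- `J 1 - J s` is the coordinate of the function (r-s)₊²/2, whose derivative is this ramp. It
vanishes up to `s`, so it does not see lower points. -/
theorem inner_ramp_J {s r : ℝ} (hs : s ∈ I01) (hr : r ∈ I01) :
    ⟪J 1 - J s, J r⟫ = max (r - s) 0 := by
  rw [inner_sub_left, inner_J_J (by simp) hr, inner_J_J hs hr, min_comm s,
    min_eq_sub_posPart r, min_eq_right hr.2]
  ring

theorem inner_ramp_Psi {s r : ℝ} (hs : s ∈ I01) (hr : r ∈ I01) :
    ⟪J 1 - J s, Psi r⟫ = max (r - s) 0 ^ 2 / 2 := by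
  refine eq_of_hasDerivAt_eq (f := fun r => ⟪J 1 - J s, Psi r⟫)
    (g := fun r => max (r - s) 0 ^ 2 / 2)
    (fun y => HasDerivAt.inner_const_left _ (hasDerivAt_Psi y))
    (fun y => (hasDerivAt_posPart_sub 0 s y).div_const 2) (fun y hy => ?_) ?_ hr
  · rw [inner_ramp_J hs hy]; push_cast; ring
  · simp [Psi_zero, hs.1]

theorem inner_ramp_PsiCap {α : ℝ} (hlt : α < 1) {s η : ℝ} (hs : s ∈ I01) (hη : η ∈ I01) :
    ⟪J 1 - J s, PsiCap α η⟫
      = 1 / Real.Gamma (1 - α) * ∫ r in (0 : ℝ)..η, max (r - s) 0 / (η - r) ^ α := by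
  refine (apply_PsiCap hlt (innerSL ℝ (J 1 - J s)) hη.1).trans ?_
  congr 1
  refine intervalIntegral.integral_congr fun r hr => ?_
  rw [uIcc_of_le hη.1] at hr
  simp only [innerSL_apply_apply]
  rw [inner_ramp_J hs ⟨hr.1, hr.2.trans hη.2⟩]

theorem inner_ramp_PsiCap_eq_zero {α : ℝ} (h1 : α ≤ 1) {s η : ℝ} (hs : s ∈ I01) (hη : η ∈ I01)
    (h : η ≤ s) : ⟪J 1 - J s, PsiCap α η⟫ = 0 := by
  by_cases hα : α = 1
  · rw [PsiCap, if_pos hα, inner_ramp_J hs hη, max_eq_right (by linarith)]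
  rw [inner_ramp_PsiCap (lt_of_le_of_ne h1 hα) hs hη]
  have : ∫ r in (0 : ℝ)..η, max (r - s) 0 / (η - r) ^ α = ∫ r in (0 : ℝ)..η, (0 : ℝ) := by
    refine intervalIntegral.integral_congr fun r hr => ?_
    rw [uIcc_of_le hη.1] at hr
    rw [max_eq_right (by linarith [hr.2]), zero_div]
  rw [this]; simp

theorem integral_posPart {s η : ℝ} (hs : 0 ≤ s) (h : s ≤ η) :
    ∫ r in (0 : ℝ)..η, max (r - s) 0 = (η - s) ^ 2 / 2 := by
  have h1 : ∀ r ∈ uIcc 0 η, HasDerivAt (fun r => max (r - s) 0 ^ 2 / 2) (max (r - s) 0) r :=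
    fun r _ => ((hasDerivAt_posPart_sub 0 s r).div_const 2).congr_deriv (by push_cast; ring)
  rw [intervalIntegral.integral_eq_sub_of_hasDerivAt h1
    (Continuous.intervalIntegrable (by fun_prop) _ _), max_eq_left (by linarith),
    max_eq_right (by linarith)]
  ring

/-- On (s,η) the weight (η-r)^(-α) is at least (η-s)^(-α), and the ramp integrates to (η-s)²/2. For
α = 1 equality holds with constant 2. -/
theorem exists_le_inner_ramp_PsiCap {α : ℝ} (h0 : 0 < α) (h1 : α ≤ 1) :
    ∃ C > 0, ∀ s ∈ I01, ∀ η ∈ I01, s < η →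
      C * (η - s) ^ (-α) * ((η - s) ^ 2 / 2) ≤ ⟪J 1 - J s, PsiCap α η⟫ := by
  by_cases hα : α = 1
  · refine ⟨2, two_pos, fun s hs η hη h => ?_⟩
    have hp : 0 < η - s := by linarith
    rw [PsiCap, if_pos hα, inner_ramp_J hs hη, max_eq_left hp.le, hα, Real.rpow_neg hp.le,
      Real.rpow_one]
    apply le_of_eq
    field_simp
  have hlt := lt_of_le_of_ne h1 hα
  have hG : 0 < Real.Gamma (1 - α) := Real.Gamma_pos_of_pos (by linarith)
  refine ⟨1 / Real.Gamma (1 - α), by positivity, fun s hs η hη h => ?_⟩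
  have hp : 0 < η - s := by linarith
  rw [inner_ramp_PsiCap hlt hs hη, mul_assoc]
  refine mul_le_mul_of_nonneg_left ?_ (by positivity)
  rw [← integral_posPart hs.1 h.le, ← intervalIntegral.integral_const_mul]
  refine intervalIntegral.integral_mono_on_of_le_Ioo hη.1
    (Continuous.intervalIntegrable (by fun_prop) _ _) ?_ ?_
  · have := (intervalIntegrable_weight hlt 0 η).mul_continuousOn
      (g := fun r => max (r - s) 0) (by fun_prop)
    refine this.congr fun r hr => ?_
    rw [uIoc_of_le hη.1] at hr
    rw [Real.rpow_neg (by linarith [hr.2]), inv_mul_eq_div]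
  · intro r hr
    have hr' : 0 < η - r := by linarith [hr.2]
    rcases le_or_gt r s with h' | h'
    · rw [max_eq_right (by linarith)]; simp
    · rw [div_eq_mul_inv, ← Real.rpow_neg hr'.le, mul_comm]
      refine mul_le_mul_of_nonneg_left ?_ (le_max_right _ _)
      exact Real.rpow_le_rpow_of_nonpos hr' (by linarith) (by linarith)

/-- The sum is at least (C(τ-s)^(-α) + k)(τ-s)²/2, and the first factor tends to infinity because α
> 0. -/
theorem eventually_ramp_pos {α : ℝ} (h0 : 0 < α) (h1 : α ≤ 1) (k : ℝ) {τ : ℝ} (hτ : τ ∈ I01)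
    (hpos : 0 < τ) :
    ∀ᶠ s in 𝓝[<] τ, s ∈ I01 ∧ 0 < ⟪J 1 - J s, PsiCap α τ⟫ + k * ⟪J 1 - J s, Psi τ⟫ := by
  obtain ⟨C, hC, H⟩ := exists_le_inner_ramp_PsiCap h0 h1
  have ht : Tendsto (fun s => τ - s) (𝓝[<] τ) (𝓝[>] 0) := by
    refine tendsto_nhdsWithin_iff.2 ⟨?_, ?_⟩
    · have : Continuous fun s : ℝ => τ - s := by fun_prop
      simpa using (this.tendsto τ).mono_left nhdsWithin_le_nhds
    · filter_upwards [self_mem_nhdsWithin] with s hs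
      exact sub_pos.2 (mem_Iio.1 hs)
  have hbig := (tendsto_rpow_neg_nhdsGT_zero (neg_lt_zero.2 h0)).comp ht
  filter_upwards [hbig.eventually_gt_atTop (-k / C), self_mem_nhdsWithin,
    mem_nhdsWithin_of_mem_nhds (Ioi_mem_nhds hpos)] with s hs hsτ hs0
  have hsI : s ∈ I01 := ⟨le_of_lt hs0, (le_of_lt hsτ).trans hτ.2⟩
  have hp : 0 < τ - s := sub_pos.2 (mem_Iio.1 hsτ)
  refine ⟨hsI, ?_⟩
  have hb := H s hsI τ hτ hsτ
  rw [inner_ramp_Psi hsI hτ, max_eq_left hp.le]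
  have hs' : 0 < C * (τ - s) ^ (-α) + k := by
    rw [Function.comp_apply, div_lt_iff₀ hC] at hs
    linarith
  nlinarith [mul_pos hs' (pow_pos hp 2)]

/-! ### Test functions in the first variable -/

section Bump

variable {φ φ₁ φ₂ φ₃ : ℝ → ℝ}

theorem inner_toLp_Phi (h0 : ∀ x, HasDerivAt φ (φ₁ x) x) (h1 : ∀ x, HasDerivAt φ₁ (φ₂ x) x)
    (h2 : ∀ x, HasDerivAt φ₂ (φ₃ x) x) (h3 : Continuous φ₃) (hm : MemLp φ₃ 2 refMeasure)
    (z0 : φ 0 = 0) (z1 : φ₁ 0 = 0) (z2 : φ₂ 0 = 0) (z3 : φ₃ 0 = 0) (e : φ 1 = 0)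
    {x : ℝ} (hx : x ∈ I01) :
    ⟪hm.toLp, Phi x⟫ = φ x ∧ ⟪hm.toLp, Phi1 x⟫ = φ₁ x ∧ ⟪hm.toLp, Phi2 x⟫ = φ₂ x := by
  have hind : ∀ (s : Set ℝ) (hs : MeasurableSet s), ⟪hm.toLp, ind s hs⟫
      = ∫ r in s, φ₃ r ∂refMeasure := fun s hs => by
    rw [real_inner_comm, inner_ind_left]
    exact integral_congr_ae (ae_restrict_of_ae hm.coeFn_toLp)
  -- The value at the atom plays the role of the slope φ'(0), which is 0; the class of `φ₃` takes
  -- the value `φ₃ 0` there, hence the need for `z3`.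
  have hJ : ⟪hm.toLp, J 0⟫ = 0 := by
    rw [J_zero_eq, hind, refMeasure_restrict_zero, integral_dirac, z3]
  have a2 : ∀ x ∈ I01, ⟪hm.toLp, Th2 x⟫ = φ₂ x := fun x hx => by
    rw [Th2_eq_ind hx, hind, refMeasure_restrict_Ioc hx, ← intervalIntegral.integral_of_le hx.1,
      intervalIntegral.integral_eq_sub_of_hasDerivAt (fun r _ => h2 r)
        (h3.intervalIntegrable _ _), z2, sub_zero]
  have a1 : ∀ x ∈ I01, ⟪hm.toLp, Th1 x⟫ = φ₁ x := fun x hx =>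
    eq_of_hasDerivAt_eq (f := fun x => ⟪hm.toLp, Th1 x⟫)
      (fun y => HasDerivAt.inner_const_left _ (hasDerivAt_Th1 y)) h1 a2
      (by simp only [Th1_zero, hJ, z1]) hx
  have a0 : ∀ x ∈ I01, ⟪hm.toLp, Th0 x⟫ = φ x := fun x hx =>
    eq_of_hasDerivAt_eq (f := fun x => ⟪hm.toLp, Th0 x⟫)
      (fun y => HasDerivAt.inner_const_left _ (hasDerivAt_Th0 y)) h0 a1
      (by simp [Th0_zero, z0]) hx
  have a01 := a0 1 (by simp)
  rw [e] at a01
  simp only [Phi, Phi1, Phi2, inner_sub_right, real_inner_smul_right, a01, a0 x hx, a1 x hx,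
    a2 x hx, mul_zero, sub_zero, and_self]

end Bump

theorem deriv_eq_zero_of_eventuallyEq_const {φ : ℝ → ℝ} {x a : ℝ} (h : φ =ᶠ[𝓝 x] fun _ => a) :
    deriv φ =ᶠ[𝓝 x] fun _ => 0 := by
  refine h.eventually_nhds.mono fun y hy => ?_
  have : φ =ᶠ[𝓝 y] fun _ => a := hy
  rw [this.deriv_eq]; simp

theorem exists_localized (X : Finset ℝ) {x₀ : ℝ} (hx₀ : x₀ ∈ Ioo (0 : ℝ) 1) (hX : x₀ ∉ X) :
    ∃ f : H1, (⟪f, Phi x₀⟫ = 1 ∧ ⟪f, Phi1 x₀⟫ = 0 ∧ ⟪f, Phi2 x₀⟫ = 0) ∧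
      ∀ x ∈ X, x ∈ I01 → ⟪f, Phi x⟫ = 0 ∧ ⟪f, Phi1 x⟫ = 0 ∧ ⟪f, Phi2 x⟫ = 0 := by
  classical
  -- Avoiding 0 and 1 as well makes the bump satisfy the side conditions. It is 1 near x₀ and 0 near
  -- the excluded points, so its derivatives vanish at all of them.
  obtain ⟨ε, hε, hball⟩ : ∃ ε > 0, Metric.ball x₀ ε ⊆ ((insert 0 (insert 1 X) : Finset ℝ) : Set ℝ)ᶜ := by
    refine Metric.isOpen_iff.1 (Finset.finite_toSet _).isClosed.isOpen_compl x₀ ?_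
    simp [hx₀.1.ne', hx₀.2.ne, hX]
  let b : ContDiffBump x₀ := ⟨ε / 3, ε / 2, by positivity, by linarith⟩
  have hs : ContDiff ℝ 3 b := b.contDiff
  have hs1 : ContDiff ℝ 2 (deriv b) := ((contDiff_succ_iff_deriv (n := 2)).1 hs).2.2
  have hs2 : ContDiff ℝ 1 (deriv (deriv b)) := ((contDiff_succ_iff_deriv (n := 1)).1 hs1).2.2
  have hs3 : Continuous (deriv (deriv (deriv b))) := hs2.continuous_deriv le_rfl
  have hm : MemLp (deriv (deriv (deriv b))) 2 refMeasure :=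
    hs3.memLp_of_hasCompactSupport b.hasCompactSupport.deriv.deriv.deriv
  have hfar : ∀ x, x ∈ (insert 0 (insert 1 X) : Finset ℝ) → (b : ℝ → ℝ) =ᶠ[𝓝 x] fun _ => 0 := by
    intro x hx
    have hd : x ∉ tsupport b := by
      rw [b.tsupport_eq]
      intro h
      refine hball (Metric.closedBall_subset_ball (by change ε / 2 < ε; linarith) h) ?_
      exact_mod_cast hx
    exact notMem_tsupport_iff_eventuallyEq.1 hd
  have hnear : (b : ℝ → ℝ) =ᶠ[𝓝 x₀] fun _ => 1 := b.eventuallyEq_one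
  have d0 := fun x hx => deriv_eq_zero_of_eventuallyEq_const (hfar x hx)
  have d1 := fun x hx => deriv_eq_zero_of_eventuallyEq_const (d0 x hx)
  have d2 := fun x hx => deriv_eq_zero_of_eventuallyEq_const (d1 x hx)
  have n0 := deriv_eq_zero_of_eventuallyEq_const hnear
  have n1 := deriv_eq_zero_of_eventuallyEq_const n0
  have m0 : (0 : ℝ) ∈ (insert 0 (insert 1 X) : Finset ℝ) := by simp
  have m1 : (1 : ℝ) ∈ (insert 0 (insert 1 X) : Finset ℝ) := by simp
  have key := fun x (hx : x ∈ I01) => inner_toLp_Phi (φ := b)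
    (fun x => (hs.differentiable (by norm_num) x).hasDerivAt)
    (fun x => (hs1.differentiable (by norm_num) x).hasDerivAt)
    (fun x => (hs2.differentiable (by norm_num) x).hasDerivAt) hs3 hm
    (hfar 0 m0).eq_of_nhds (d0 0 m0).eq_of_nhds (d1 0 m0).eq_of_nhds (d2 0 m0).eq_of_nhds
    (hfar 1 m1).eq_of_nhds hx
  refine ⟨hm.toLp, ?_, fun x hx hxI => ?_⟩
  · have := key x₀ ⟨hx₀.1.le, hx₀.2.le⟩
    rwa [hnear.eq_of_nhds, n0.eq_of_nhds, n1.eq_of_nhds] at this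
  · have hx' : x ∈ (insert 0 (insert 1 X) : Finset ℝ) := by simp [hx]
    have := key x hxI
    rwa [(hfar x hx').eq_of_nhds, (d0 x hx').eq_of_nhds, (d1 x hx').eq_of_nhds] at this

/-! ### Linear independence -/

/-- A linear relation is paired with bump ⊗ ramp. The bump removes the other vertical lines, the
ramp the lower points on the line through `z`, so a single nonzero term is left. -/
theorem ell_notMem_span {α : ℝ} (h0 : 0 < α) (h1 : α ≤ 1) (k₁ k₂ k₃ : ℝ → ℝ → ℝ)
    (S : Finset (ℝ × ℝ)) (hS : ∀ q ∈ S, q ∈ D) {z : ℝ × ℝ} (hz1 : z.1 ∈ Ioo (0 : ℝ) 1)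
    (hz2 : z.2 ∈ Ioc (0 : ℝ) 1) (hz : z ∉ S) :
    ell α k₁ k₂ k₃ z ∉ Submodule.span ℝ (ell α k₁ k₂ k₃ '' S) := by
  classical
  intro hmem
  rw [Submodule.mem_span_image_finset_iff_exists_fun] at hmem
  obtain ⟨a, ha⟩ : ∃ a : ℝ × ℝ → ℝ,
      ∑ q ∈ S, a q • ell α k₁ k₂ k₃ q = ell α k₁ k₂ k₃ z := by
    obtain ⟨a, ha⟩ := hmem
    refine ⟨fun q => if h : q ∈ S then a ⟨q, h⟩ else 0, ?_⟩
    rw [← ha, ← Finset.sum_coe_sort]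
    exact Finset.sum_congr rfl fun q _ => by simp
  have hzD : z ∈ D := ⟨⟨hz1.1.le, hz1.2.le⟩, ⟨hz2.1.le, hz2.2⟩⟩
  set d : ℝ × ℝ → ℝ := fun q => if q = z then -1 else a q with hd
  set S' := insert z S with hS'
  have hS'D : ∀ q ∈ S', q ∈ D := by
    intro q hq
    rcases Finset.mem_insert.1 hq with rfl | hq
    exacts [hzD, hS q hq]
  have hsum : ∑ q ∈ S', d q • ell α k₁ k₂ k₃ q = 0 := by
    rw [hS', Finset.sum_insert hz]
    have : ∑ q ∈ S, d q • ell α k₁ k₂ k₃ q = ∑ q ∈ S, a q • ell α k₁ k₂ k₃ q :=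
      Finset.sum_congr rfl fun q hq => by
        have hne : q ≠ z := fun h => hz (h ▸ hq)
        simp [hd, hne]
    rw [this, ha, hd]; simp
  -- The highest point on the line that really occurs in the relation; `z` is a candidate since its
  -- coefficient is -1, so the maximum has positive height.
  obtain ⟨q₀, hq₀, hmax⟩ := (S'.filter fun q => q.1 = z.1 ∧ d q ≠ 0).exists_max_image Prod.snd
    ⟨z, by simp [hS', hd]⟩
  have hz_le := hmax z (by simp [hS', hd])
  rw [Finset.mem_filter] at hq₀
  obtain ⟨hq₀S, hq₀z, hq₀d⟩ := hq₀
  have hτ : q₀.2 ∈ I01 := (hS'D _ hq₀S).2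
  have hev : ∀ᶠ s in 𝓝[<] q₀.2, ∀ q ∈ S', q.2 < q₀.2 → q.2 ≤ s := by
    rw [Filter.eventually_all_finset]
    intro q _
    by_cases hq : q.2 < q₀.2
    · filter_upwards [mem_nhdsWithin_of_mem_nhds (Ioi_mem_nhds hq)] with s hs _
      exact le_of_lt hs
    · exact Eventually.of_forall fun s h => absurd h hq
  obtain ⟨s, ⟨hsI, hpos⟩, hs⟩ := ((eventually_ramp_pos h0 h1 (k₂ q₀.1 q₀.2) hτ
    (hz2.1.trans_le hz_le)).and hev).exists
  obtain ⟨f, ⟨f0, f1, f2⟩, hf⟩ := exists_localized ((S'.image Prod.fst).erase z.1) hz1 (by simp)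
  have hzero : ∑ q ∈ S', d q * ⟪tens f (J 1 - J s), ell α k₁ k₂ k₃ q⟫ = 0 := by
    have := congrArg (fun v => ⟪tens f (J 1 - J s), v⟫) hsum
    simpa only [inner_sum, real_inner_smul_right, inner_zero_right] using this
  rw [Finset.sum_eq_single_of_mem q₀ hq₀S] at hzero
  · rw [inner_ell] at hzero
    simp only [inner_tens, hq₀z, f0, f1, f2] at hzero
    rw [hq₀z] at hpos
    rcases mul_eq_zero.1 hzero with h | h
    · exact hq₀d h
    · linarith
  · intro q hq hne
    have hqD := hS'D q hq
    by_cases hqz : q.1 = z.1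
    · by_cases hdq : d q = 0
      · rw [hdq, zero_mul]
      have hle : q.2 ≤ q₀.2 := hmax q (by simp [hq, hqz, hdq])
      have hlt : q.2 < q₀.2 := lt_of_le_of_ne hle fun h =>
        hne (Prod.ext (hqz.trans hq₀z.symm) h)
      have hqs := hs q hq hlt
      rw [inner_ell]
      simp only [inner_tens, inner_ramp_PsiCap_eq_zero h1 hsI hqD.2 hqs,
        inner_ramp_Psi hsI hqD.2, max_eq_right (sub_nonpos.2 hqs)]
      simp
    · obtain ⟨g0, g1, g2⟩ := hf q.1
        (Finset.mem_erase.2 ⟨hqz, Finset.mem_image_of_mem _ hq⟩) hqD.1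
      rw [inner_ell]
      simp only [inner_tens, g0, g1, g2, zero_mul, mul_zero, add_zero]

/-! ### Gram–Schmidt orthonormalization with skipped vectors -/

section GramSchmidt

variable {H : Type*} [NormedAddCommGroup H] [InnerProductSpace ℝ H]

/-- The combination `∑_{k ≤ i} β_ik v_k`. -/
def gsVec (v : ℕ → H) (β : ℕ → ℕ → ℝ) (i : ℕ) : H := ∑ k ∈ Finset.range (i + 1), β i k • v k

/-- The coefficients of the `i`-th vector minus its projections on the previous ones. -/
def gsGamma (v : ℕ → H) (β : ℕ → ℕ → ℝ) (i k : ℕ) : ℝ :=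
  (if k = i then 1 else 0) - ∑ j ∈ Finset.range i, ⟪v i, gsVec v β j⟫ * β j k

/-- The `i`-th vector minus its projections on the previous ones. -/
def gsRes (v : ℕ → H) (β : ℕ → ℕ → ℝ) (i : ℕ) : H :=
  ∑ l ∈ Finset.range (i + 1), gsGamma v β i l • v l

/-- `β` consists of the Gram–Schmidt coefficients of the sequence `v`. -/
def IsGramSchmidt (v : ℕ → H) (β : ℕ → ℕ → ℝ) : Prop :=
  ∀ i k, β i k = gsGamma v β i k / ‖gsRes v β i‖

variable {v : ℕ → H} {β : ℕ → ℕ → ℝ}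

namespace IsGramSchmidt

theorem coeff_eq_zero_of_lt (h : IsGramSchmidt v β) (i : ℕ) : ∀ l, i < l → β i l = 0 := by
  induction i using Nat.strong_induction_on with
  | _ i ih =>
    intro l hl
    rw [h, gsGamma, if_neg hl.ne', Finset.sum_eq_zero, sub_zero, zero_div]
    intro j hj
    rw [ih j (Finset.mem_range.1 hj) l ((Finset.mem_range.1 hj).trans hl), mul_zero]

theorem gamma_self (h : IsGramSchmidt v β) (i : ℕ) : gsGamma v β i i = 1 := by
  rw [gsGamma, if_pos rfl, Finset.sum_eq_zero, sub_zero]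
  intro j hj
  rw [h.coeff_eq_zero_of_lt j i (Finset.mem_range.1 hj), mul_zero]

/-- Row `l` is zero by division by zero, and later rows receive `v l` only through earlier rows.
Hence the data at a skipped index never enter any coefficient. -/
theorem coeff_eq_zero_of_res (h : IsGramSchmidt v β) {l : ℕ} (hl : gsRes v β l = 0) (i : ℕ) :
    β i l = 0 := by
  induction i using Nat.strong_induction_on with
  | _ i ih =>
    by_cases hil : l = i
    · subst hil; rw [h, hl, norm_zero, div_zero]
    · rw [h, gsGamma, if_neg hil, Finset.sum_eq_zero, sub_zero, zero_div]
      intro j hj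
      rw [ih j (Finset.mem_range.1 hj), mul_zero]

theorem gsVec_eq (h : IsGramSchmidt v β) {j n : ℕ} (hj : j < n) :
    ∑ k ∈ Finset.range n, β j k • v k = gsVec v β j := by
  refine (Finset.sum_subset (Finset.range_subset_range.2 hj) fun k _ hk => ?_).symm
  rw [h.coeff_eq_zero_of_lt j k (by simpa using hk), zero_smul]

theorem res_eq (h : IsGramSchmidt v β) (i : ℕ) :
    gsRes v β i = v i - ∑ j ∈ Finset.range i, ⟪v i, gsVec v β j⟫ • gsVec v β j := by
  simp only [gsRes, gsGamma, sub_smul, Finset.sum_sub_distrib]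
  congr 1
  · rw [Finset.sum_eq_single_of_mem i (by simp) fun k _ hk => by rw [if_neg hk, zero_smul]]
    simp
  · simp only [Finset.sum_smul, mul_smul]
    rw [Finset.sum_comm]
    refine Finset.sum_congr rfl fun j hj => ?_
    rw [← Finset.smul_sum, h.gsVec_eq (by have := Finset.mem_range.1 hj; omega)]

theorem gsVec_eq_smul_res (h : IsGramSchmidt v β) (i : ℕ) :
    gsVec v β i = ‖gsRes v β i‖⁻¹ • gsRes v β i := by
  conv_rhs => rw [gsRes, Finset.smul_sum]
  refine Finset.sum_congr rfl fun k _ => ?_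
  rw [h i k, smul_smul, inv_mul_eq_div]
  rfl

theorem norm_gsVec (h : IsGramSchmidt v β) {i : ℕ} (hi : gsRes v β i ≠ 0) :
    ‖gsVec v β i‖ = 1 := by
  rw [h.gsVec_eq_smul_res, norm_smul, norm_inv, norm_norm,
    inv_mul_cancel₀ (norm_ne_zero_iff.2 hi)]

theorem gsVec_eq_zero (h : IsGramSchmidt v β) {i : ℕ} (hi : gsRes v β i = 0) :
    gsVec v β i = 0 := by
  rw [h.gsVec_eq_smul_res, hi, smul_zero]

theorem inner_gsVec_of_lt (h : IsGramSchmidt v β) (i : ℕ) :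
    ∀ j < i, ⟪gsVec v β j, gsVec v β i⟫ = 0 := by
  induction i using Nat.strong_induction_on with
  | _ i ih =>
    intro j hj
    rw [h.gsVec_eq_smul_res i, real_inner_smul_right, h.res_eq, inner_sub_right, inner_sum,
      Finset.sum_eq_single_of_mem (f := fun k => ⟪gsVec v β j, ⟪v i, gsVec v β k⟫ • gsVec v β k⟫) j
        (by simpa using hj)]
    · rw [real_inner_smul_right, real_inner_self_eq_norm_sq, real_inner_comm]
      -- A skipped vector is 0; otherwise its norm is 1 and the projection cancels exactly.
      by_cases hz : gsRes v β j = 0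
      · rw [h.gsVec_eq_zero hz]; simp
      · rw [h.norm_gsVec hz]; simp
    · intro k hk hkj
      rw [real_inner_smul_right]
      rcases lt_or_gt_of_ne hkj with hlt | hlt
      · rw [real_inner_comm (gsVec v β k) (gsVec v β j), ih j hj k hlt, mul_zero]
      · rw [ih k (Finset.mem_range.1 hk) j hlt, mul_zero]

theorem inner_gsVec_of_ne (h : IsGramSchmidt v β) {i j : ℕ} (hij : i ≠ j) :
    ⟪gsVec v β i, gsVec v β j⟫ = 0 := by
  rcases lt_or_gt_of_ne hij with hlt | hlt
  · exact h.inner_gsVec_of_lt j i hlt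
  · rw [real_inner_comm]; exact h.inner_gsVec_of_lt i j hlt

theorem res_ne_zero (h : IsGramSchmidt v β) {i : ℕ}
    (hi : v i ∉ Submodule.span ℝ (v '' Iio i)) : gsRes v β i ≠ 0 := by
  intro h0
  apply hi
  rw [h.res_eq, sub_eq_zero] at h0
  rw [h0]
  refine Submodule.sum_mem _ fun j hj => Submodule.smul_mem _ _ (Submodule.sum_mem _ fun k hk =>
    Submodule.smul_mem _ _ (Submodule.subset_span (mem_image_of_mem v ?_)))
  have := Finset.mem_range.1 hj
  have := Finset.mem_range.1 hk
  exact mem_Iio.2 (by omega)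

variable {B F : ℕ → ℝ}

theorem expansion_coeff_eq_zero (h : IsGramSchmidt v β)
    (hB : ∀ i, B i = ∑ k ∈ Finset.range (i + 1), β i k * F k) {i : ℕ} (hi : gsRes v β i = 0) :
    B i = 0 := by
  rw [hB, Finset.sum_eq_zero]
  intro k _
  rw [h, hi, norm_zero, div_zero, zero_mul]

theorem mul_inner_gsVec_self (h : IsGramSchmidt v β)
    (hB : ∀ i, B i = ∑ k ∈ Finset.range (i + 1), β i k * F k) (i : ℕ) :
    B i * ⟪gsVec v β i, gsVec v β i⟫ = B i := by
  by_cases hz : gsRes v β i = 0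
  · rw [h.expansion_coeff_eq_zero hB hz, zero_mul]
  · rw [real_inner_self_eq_norm_sq, h.norm_gsVec hz]; simp

/-- Pythagoras; where the vector was skipped, `B i` is zero too. -/
theorem norm_sq_sum (h : IsGramSchmidt v β)
    (hB : ∀ i, B i = ∑ k ∈ Finset.range (i + 1), β i k * F k) (t : Finset ℕ) :
    ‖∑ i ∈ t, B i • gsVec v β i‖ ^ 2 = ∑ i ∈ t, B i ^ 2 := by
  rw [← real_inner_self_eq_norm_sq, sum_inner]
  refine Finset.sum_congr rfl fun i hi => ?_
  rw [inner_sum, Finset.sum_eq_single_of_mem i hi]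
  · rw [real_inner_smul_left, real_inner_smul_right, h.mul_inner_gsVec_self hB, sq]
  · intro j _ hj
    rw [real_inner_smul_left, real_inner_smul_right, h.inner_gsVec_of_ne hj.symm]; simp

theorem summable_of_bounded [CompleteSpace H] (h : IsGramSchmidt v β)
    (hB : ∀ i, B i = ∑ k ∈ Finset.range (i + 1), β i k * F k) {C : ℝ}
    (hC : ∀ n, ‖∑ i ∈ Finset.range (n + 1), B i • gsVec v β i‖ ≤ C) :
    Summable fun i => B i • gsVec v β i := by
  have hs : Summable fun i => B i ^ 2 := by
    refine summable_of_sum_range_le (c := C ^ 2) (fun i => sq_nonneg _) fun n => ?_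
    calc ∑ i ∈ Finset.range n, B i ^ 2 ≤ ∑ i ∈ Finset.range (n + 1), B i ^ 2 :=
          Finset.sum_le_sum_of_subset_of_nonneg (Finset.range_subset_range.2 n.le_succ)
            fun i _ _ => sq_nonneg _
      _ = ‖∑ i ∈ Finset.range (n + 1), B i • gsVec v β i‖ ^ 2 := (h.norm_sq_sum hB _).symm
      _ ≤ C ^ 2 := pow_le_pow_left₀ (norm_nonneg _) (hC n) 2
  rw [summable_iff_vanishing_norm] at hs ⊢
  intro ε hε
  obtain ⟨s, hs⟩ := hs (ε ^ 2) (by positivity)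
  refine ⟨s, fun t ht => ?_⟩
  have := hs t ht
  rw [← h.norm_sq_sum hB, norm_pow, norm_norm] at this
  exact lt_of_pow_lt_pow_left₀ 2 hε.le this

theorem inner_gsVec_of_hasSum (h : IsGramSchmidt v β)
    (hB : ∀ i, B i = ∑ k ∈ Finset.range (i + 1), β i k * F k) {c : H}
    (hc : HasSum (fun i => B i • gsVec v β i) c) (j : ℕ) : ⟪c, gsVec v β j⟫ = B j := by
  have h1 : HasSum (fun i => ⟪gsVec v β j, B i • gsVec v β i⟫) ⟪gsVec v β j, c⟫ :=
    (innerSL ℝ (gsVec v β j)).hasSum hc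
  have h2 := hasSum_single (f := fun i => ⟪gsVec v β j, B i • gsVec v β i⟫) j fun i hi => by
    rw [real_inner_smul_right, h.inner_gsVec_of_ne hi.symm, mul_zero]
  rw [real_inner_comm, h1.unique h2, real_inner_smul_right, h.mul_inner_gsVec_self hB]

/-- Pairing `c` with the k-th orthonormal vector gives the same triangular combination of the ⟪c, v
l⟫ as of the F l. Skipped columns vanish, earlier ones agree by induction, and the diagonal entry is
nonzero. -/
theorem inner_of_hasSum (h : IsGramSchmidt v β)
    (hB : ∀ i, B i = ∑ k ∈ Finset.range (i + 1), β i k * F k) {c : H}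
    (hc : HasSum (fun i => B i • gsVec v β i) c) (k : ℕ) :
    gsRes v β k ≠ 0 → ⟪c, v k⟫ = F k := by
  induction k using Nat.strong_induction_on with
  | _ k ih =>
    intro hk
    have h1 := h.inner_gsVec_of_hasSum hB hc k
    rw [hB, gsVec, inner_sum, Finset.sum_range_succ, Finset.sum_range_succ] at h1
    have h2 : ∑ l ∈ Finset.range k, ⟪c, β k l • v l⟫ = ∑ l ∈ Finset.range k, β k l * F l := by
      refine Finset.sum_congr rfl fun l hl => ?_
      rw [real_inner_smul_right]
      by_cases hz : gsRes v β l = 0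
      · rw [h.coeff_eq_zero_of_res hz, zero_mul, zero_mul]
      · rw [ih l (Finset.mem_range.1 hl) hz]
    rw [h2, add_right_inj, real_inner_smul_right] at h1
    refine mul_left_cancel₀ ?_ h1
    rw [h, h.gamma_self]
    exact one_div_ne_zero (norm_ne_zero_iff.2 hk)

end IsGramSchmidt

end GramSchmidt

/-- The coefficients depend only on inner products and norms, which the coordinates preserve. -/
theorem isGramSchmidt_gsCoeff {ψ : ℕ → ℝ → ℝ → ℝ} {v : ℕ → H2}
    (h : ∀ i, Repr (ψ i) (v i) Phi Psi) : IsGramSchmidt v (gsCoeff ψ) := by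
  have hbar : ∀ j, Repr (∑ k ∈ Finset.range (j + 1), gsCoeff ψ j k • ψ k)
      (gsVec v (gsCoeff ψ) j) Phi Psi := fun j => Repr.sum_smul _ _ fun k _ => h k
  intro i k
  have hγ : ∀ k, ((if k = i then 1 else 0) - ∑ j : Fin i,
      innerW (ψ i) (∑ k ∈ Finset.range (j.1 + 1), gsCoeff ψ j.1 k • ψ k) * gsCoeff ψ j.1 k)
      = gsGamma v (gsCoeff ψ) i k := by
    intro k
    rw [gsGamma, Finset.sum_range]
    congr 1
    exact Finset.sum_congr rfl fun j _ => by rw [innerW_eq (h i) (hbar j)]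
  rw [gsCoeff]
  simp only [hγ]
  rw [normW_eq (Repr.sum_smul _ _ fun l _ => h l)]
  rfl

theorem repr_gsBar {ψ : ℕ → ℝ → ℝ → ℝ} {v : ℕ → H2} (h : ∀ i, Repr (ψ i) (v i) Phi Psi) (i : ℕ) :
    Repr (gsBar ψ i) (gsVec v (gsCoeff ψ) i) Phi Psi :=
  Repr.sum_smul _ _ fun k _ => h k

/-! ### Density of the points that are not skipped -/

theorem exists_res_ne_zero_near {α : ℝ} (h0 : 0 < α) (h1 : α ≤ 1) (k₁ k₂ k₃ : ℝ → ℝ → ℝ)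
    {p : ℕ → ℝ × ℝ} (hpD : ∀ i, p i ∈ D) (hp : D ⊆ closure (range p)) {β : ℕ → ℕ → ℝ}
    (hβ : IsGramSchmidt (fun i => ell α k₁ k₂ k₃ (p i)) β) {z : ℝ × ℝ} (hz : z ∈ D)
    {U : Set (ℝ × ℝ)} (hU : U ∈ 𝓝 z) (N : ℕ) :
    ∃ k ≥ N, p k ∈ U ∧ gsRes (fun i => ell α k₁ k₂ k₃ (p i)) β k ≠ 0 := by
  classical
  have hO : IsOpen (Ioo (0 : ℝ) 1 ×ˢ Ioo (0 : ℝ) 1) := isOpen_Ioo.prod isOpen_Ioo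
  have hzc : z ∈ closure (Ioo (0 : ℝ) 1 ×ˢ Ioo (0 : ℝ) 1) := by
    rw [closure_prod_eq, closure_Ioo zero_ne_one]; exact hz
  obtain ⟨w₀, hw₀U, hw₀O⟩ := mem_closure_iff_nhds.1 hzc _ (interior_mem_nhds.2 hU)
  have hV₀ : IsOpen (interior U ∩ Ioo (0 : ℝ) 1 ×ˢ Ioo (0 : ℝ) 1) := isOpen_interior.inter hO
  have hinf := infinite_of_mem_nhds w₀ (hV₀.mem_nhds ⟨hw₀U, hw₀O⟩)
  set T : Finset (ℝ × ℝ) := (Finset.range N).image p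
  obtain ⟨w, hwV, hwT⟩ := hinf.exists_notMem_finset T
  have hV : IsOpen ((interior U ∩ Ioo (0 : ℝ) 1 ×ˢ Ioo (0 : ℝ) 1) \ T) :=
    hV₀.sdiff T.finite_toSet.isClosed
  have hwD : w ∈ D := ⟨Ioo_subset_Icc_self hwV.2.1, Ioo_subset_Icc_self hwV.2.2⟩
  obtain ⟨_, hk, k₀, rfl⟩ := mem_closure_iff_nhds.1 (hp hwD) _ (hV.mem_nhds ⟨hwV, hwT⟩)
  -- The least such index gives a point different from all its predecessors, hence not skipped;
  -- removing `T` forces the index to be at least `N`.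
  have hex : ∃ k, p k ∈ (interior U ∩ Ioo (0 : ℝ) 1 ×ˢ Ioo (0 : ℝ) 1) \ T := ⟨k₀, hk⟩
  have hspec := Nat.find_spec hex
  refine ⟨Nat.find hex, ?_, interior_subset hspec.1.1, hβ.res_ne_zero ?_⟩
  · by_contra hlt
    exact hspec.2 (Finset.mem_coe.2 (Finset.mem_image_of_mem p (Finset.mem_range.2 (not_le.1 hlt))))
  · have := ell_notMem_span h0 h1 k₁ k₂ k₃ ((Finset.range (Nat.find hex)).image p)
      (fun q hq => by
        obtain ⟨i, _, rfl⟩ := Finset.mem_image.1 hq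
        exact hpD i) hspec.1.2.1 (Ioo_subset_Ioc_self hspec.1.2.2) (fun hmem => by
        obtain ⟨i, hi, hie⟩ := Finset.mem_image.1 hmem
        exact Nat.find_min hex (Finset.mem_range.1 hi) (hie ▸ hspec))
    rwa [Finset.coe_image, Finset.coe_range, image_image] at this

/-! ### Passage to the limit. -/

/-- The coordinates of the partial sum of the first `n` terms of the series. -/
def partialCoord (v : ℕ → H2) (β : ℕ → ℕ → ℝ) (B : ℕ → ℝ) (n : ℕ) : H2 :=
  ∑ i ∈ Finset.range n, B i • gsVec v β i

section Main

variable {α : ℝ} {k₁ k₂ k₃ k₄ f : ℝ → ℝ → ℝ} {p : ℕ → ℝ × ℝ} {y : ℕ → ℝ → ℝ → ℝ} {B : ℕ → ℝ}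

theorem IsIteration.repr (hy : IsIteration α k₁ k₂ k₃ k₄ f p y B) (h1 : α ≤ 1)
    (hpD : ∀ i, p i ∈ D) {n : ℕ} (hn : 1 ≤ n) :
    Repr (y n) (partialCoord (fun i => ell α k₁ k₂ k₃ (p i)) (gsCoeff (psi α k₁ k₂ k₃ p)) B n)
      Phi Psi := by
  obtain ⟨m, rfl⟩ : ∃ m, n = m + 1 := ⟨n - 1, by omega⟩
  rw [hy.iterate]
  exact Repr.sum_smul _ _ fun i _ => repr_gsBar (repr_psi h1 hpD) i

theorem tendsto_inner_tens {ι : Type*} {l : Filter ι} {c : ι → H2} {c₀ : H2} {q : ι → ℝ × ℝ}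
    {z : ℝ × ℝ} {F G : ℝ → H1} (hF : Continuous F) (hG : Continuous G)
    (hc : Tendsto c l (𝓝 c₀)) (hq : Tendsto q l (𝓝 z)) :
    Tendsto (fun i => ⟪c i, tens (F (q i).1) (G (q i).2)⟫) l (𝓝 ⟪c₀, tens (F z.1) (G z.2)⟫) :=
  hc.inner (((continuous_tens hF hG).tendsto z).comp hq)

theorem inner_ell_eq_of_tendsto (hα₁ : α ≤ 1)
    (hk₁ : ContinuousOn (Function.uncurry k₁) D) (hk₂ : ContinuousOn (Function.uncurry k₂) D)
    (hk₃ : ContinuousOn (Function.uncurry k₃) D) (hk₄ : ContinuousOn (Function.uncurry k₄) D)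
    (hf : ContinuousOn (Function.uncurry f) D) (hpD : ∀ i, p i ∈ D) {l : Filter ℕ} [l.NeBot]
    {c : H2} {cn : ℕ → H2} (hcn : Tendsto cn l (𝓝 c)) {z : ℝ × ℝ} (hz : z ∈ D)
    (hlp : Tendsto p l (𝓝 z))
    (heq : ∀ᶠ k in l, ⟪c, ell α k₁ k₂ k₃ (p k)⟫ = rhsF k₄ f (p k).1 (p k).2
      ⟪cn k, tens (Phi (p k).1) (Psi (p k).2)⟫ ⟪cn k, tens (Phi1 (p k).1) (Psi (p k).2)⟫) :
    ⟪c, ell α k₁ k₂ k₃ z⟫ = rhsF k₄ f z.1 z.2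
      ⟪c, tens (Phi z.1) (Psi z.2)⟫ ⟪c, tens (Phi1 z.1) (Psi z.2)⟫ := by
  have hlD : Tendsto p l (𝓝[D] z) := tendsto_nhdsWithin_iff.2 ⟨hlp, Eventually.of_forall hpD⟩
  have hL : Tendsto (fun k => ⟪c, ell α k₁ k₂ k₃ (p k)⟫) l (𝓝 ⟪c, ell α k₁ k₂ k₃ z⟫) :=
    tendsto_const_nhds.inner ((continuousOn_ell hα₁ hk₁ hk₂ hk₃ z hz).tendsto.comp hlD)
  have hf' : Tendsto (fun k => f (p k).1 (p k).2) l (𝓝 (f z.1 z.2)) :=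
    (hf z hz).tendsto.comp hlD
  have hk₄' : Tendsto (fun k => k₄ (p k).1 (p k).2) l (𝓝 (k₄ z.1 z.2)) :=
    (hk₄ z hz).tendsto.comp hlD
  have hR := hf'.sub ((hk₄'.mul
    (tendsto_inner_tens continuous_Phi continuous_Psi hcn hlp)).mul
    (tendsto_inner_tens continuous_Phi1 continuous_Psi hcn hlp))
  exact tendsto_nhds_unique (hL.congr' heq) hR

theorem isSolution_of_hasSum (hα₀ : 0 < α) (hα₁ : α ≤ 1)
    (hk₁ : ContinuousOn (Function.uncurry k₁) D) (hk₂ : ContinuousOn (Function.uncurry k₂) D)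
    (hk₃ : ContinuousOn (Function.uncurry k₃) D) (hk₄ : ContinuousOn (Function.uncurry k₄) D)
    (hf : ContinuousOn (Function.uncurry f) D) (hpD : ∀ i, p i ∈ D)
    (hp : D ⊆ closure (Set.range p)) (hy : IsIteration α k₁ k₂ k₃ k₄ f p y B) {c : H2}
    (hc : HasSum (fun i =>
      B i • gsVec (fun i => ell α k₁ k₂ k₃ (p i)) (gsCoeff (psi α k₁ k₂ k₃ p)) i) c)
    {u : ℝ → ℝ → ℝ} (hu : Repr u c Phi Psi) : IsSolution α k₁ k₂ k₃ k₄ f u := by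
  refine ⟨hu.memW, fun ξ hξ η hη => ?_⟩
  have hGS := isGramSchmidt_gsCoeff (repr_psi (k₁ := k₁) (k₂ := k₂) (k₃ := k₃) hα₁ hpD)
  have hz : ((ξ, η) : ℝ × ℝ) ∈ D := ⟨hξ, hη⟩
  -- A filter takes the place of a subsequence: unskipped indices tending to infinity whose points
  -- tend to (ξ, η).
  obtain ⟨l, hne, hlp, hltop, hres⟩ : ∃ l : Filter ℕ, l.NeBot ∧ Tendsto p l (𝓝 (ξ, η)) ∧
      l ≤ atTop ∧ ∀ᶠ k in l, gsRes (fun i => ell α k₁ k₂ k₃ (p i))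
        (gsCoeff (psi α k₁ k₂ k₃ p)) k ≠ 0 := by
    refine ⟨(atTop ⊓ comap p (𝓝 (ξ, η))) ⊓ 𝓟 {k | gsRes (fun i => ell α k₁ k₂ k₃ (p i))
        (gsCoeff (psi α k₁ k₂ k₃ p)) k ≠ 0}, ?_,
      (tendsto_comap (f := p)).mono_left (inf_le_left.trans inf_le_right),
      inf_le_left.trans inf_le_left, (eventually_principal.2 fun k hk => hk).filter_mono inf_le_right⟩
    rw [← Filter.frequently_mem_iff_neBot, Filter.frequently_iff]
    intro S hS
    obtain ⟨S₁, hS₁, S₂, hS₂, rfl⟩ := Filter.mem_inf_iff.1 hS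
    obtain ⟨N, hN⟩ := mem_atTop_sets.1 hS₁
    obtain ⟨U, hU, hUS⟩ := hS₂
    obtain ⟨k, hkN, hkU, hk⟩ := exists_res_ne_zero_near hα₀ hα₁ k₁ k₂ k₃ hpD hp hGS hz hU N
    exact ⟨k, ⟨hN k hkN, hUS hkU⟩, hk⟩
  rw [hu.opL hα₁ hξ hη, hu ξ hξ η hη, hu.pXi hasDerivAt_Phi ξ hξ η hη]
  refine inner_ell_eq_of_tendsto hα₁ hk₁ hk₂ hk₃ hk₄ hf hpD
    (hc.tendsto_sum_nat.mono_left hltop) hz hlp ?_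
  -- Index 0 is left out: the start `y 0` is arbitrary and need not have coordinates.
  filter_upwards [(eventually_ge_atTop 1).filter_mono hltop, hres] with k hk1 hk2
  have hr := hy.repr hα₁ hpD hk1
  have e1 := hr _ (hpD k).1 _ (hpD k).2
  have e2 := hr.pXi hasDerivAt_Phi _ (hpD k).1 _ (hpD k).2
  rw [partialCoord] at e1 e2
  rw [← e1, ← e2]
  exact hGS.inner_of_hasSum hy.coeff hc k hk2

theorem convergence_of_hasSum (hα₁ : α ≤ 1) (hpD : ∀ i, p i ∈ D)
    (hy : IsIteration α k₁ k₂ k₃ k₄ f p y B) {c : H2}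
    (hc : HasSum (fun i =>
      B i • gsVec (fun i => ell α k₁ k₂ k₃ (p i)) (gsCoeff (psi α k₁ k₂ k₃ p)) i) c)
    {u : ℝ → ℝ → ℝ} (hu : Repr u c Phi Psi) :
    Tendsto (fun n => normW (y n - u)) atTop (𝓝 0) ∧
      ∀ ξ ∈ I01, ∀ η ∈ I01,
        HasSum (fun i => B i * gsBar (psi α k₁ k₂ k₃ p) i ξ η) (u ξ η) := by
  refine ⟨?_, fun ξ hξ η hη => ?_⟩
  · have h := (tendsto_iff_norm_sub_tendsto_zero.1 hc.tendsto_sum_nat)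
    refine h.congr' ?_
    filter_upwards [eventually_ge_atTop 1] with n hn
    exact (normW_eq ((hy.repr hα₁ hpD hn).sub hu)).symm
  · have h := (innerSL ℝ (tens (Phi ξ) (Psi η))).hasSum hc
    rw [innerSL_apply_apply, real_inner_comm, ← hu ξ hξ η hη] at h
    refine h.congr_fun fun i => ?_
    rw [innerSL_apply_apply, real_inner_smul_right, real_inner_comm,
      ← repr_gsBar (repr_psi hα₁ hpD) i ξ hξ η hη]

end Main

end

end FracBurgers

open FracBurgers
theorem theorem4p1 (α : ℝ) (hα₀ : 0 < α) (hα₁ : α ≤ 1)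
    (k₁ k₂ k₃ k₄ f : ℝ → ℝ → ℝ)
    (hk₁ : ContinuousOn (Function.uncurry k₁) D) (hk₂ : ContinuousOn (Function.uncurry k₂) D)
    (hk₃ : ContinuousOn (Function.uncurry k₃) D) (hk₄ : ContinuousOn (Function.uncurry k₄) D)
    (hf : ContinuousOn (Function.uncurry f) D)
    (p : ℕ → ℝ × ℝ) (hpD : ∀ i, p i ∈ D) (hp : D ⊆ closure (Set.range p))
    (y : ℕ → ℝ → ℝ → ℝ) (B : ℕ → ℝ) (hy : IsIteration α k₁ k₂ k₃ k₄ f p y B)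
    (hbdd : ∃ C : ℝ, ∀ n, 1 ≤ n → normW (y n) ≤ C) :
    (∃ u : ℝ → ℝ → ℝ, IsSolution α k₁ k₂ k₃ k₄ f u ∧
      Tendsto (fun n => normW (y n - u)) atTop (𝓝 0) ∧
      ∀ ξ ∈ I01, ∀ η ∈ I01,
        HasSum (fun i => B i * gsBar (psi α k₁ k₂ k₃ p) i ξ η) (u ξ η)) ∧
    ((∀ u v : ℝ → ℝ → ℝ, IsSolution α k₁ k₂ k₃ k₄ f u → IsSolution α k₁ k₂ k₃ k₄ f v →
        ∀ ξ ∈ I01, ∀ η ∈ I01, u ξ η = v ξ η) →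
      ∀ u : ℝ → ℝ → ℝ, IsSolution α k₁ k₂ k₃ k₄ f u →
        Tendsto (fun n => normW (y n - u)) atTop (𝓝 0) ∧
        ∀ ξ ∈ I01, ∀ η ∈ I01,
          HasSum (fun i => B i * gsBar (psi α k₁ k₂ k₃ p) i ξ η) (u ξ η)) := by
  obtain ⟨C, hC⟩ := hbdd
  have hGS := isGramSchmidt_gsCoeff (repr_psi (k₁ := k₁) (k₂ := k₂) (k₃ := k₃) hα₁ hpD)
  obtain ⟨c, hc⟩ := hGS.summable_of_bounded hy.coeff (C := C) fun n => by
    have h := hC (n + 1) (by omega)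
    rwa [normW_eq (hy.repr hα₁ hpD (by omega))] at h
  have hu₀ : Repr (fun ξ η => inner ℝ c (tens (Phi ξ) (Psi η))) c Phi Psi :=
    fun ξ _ η _ => rfl
  have hsol := isSolution_of_hasSum hα₀ hα₁ hk₁ hk₂ hk₃ hk₄ hf hpD hp hy hc hu₀
  refine ⟨⟨_, hsol, convergence_of_hasSum hα₁ hpD hy hc hu₀⟩, fun huniq u hu => ?_⟩
  -- `Repr` depends only on values on `D`, so a solution equal there to the limit inherits its
  -- coordinates.
  exact convergence_of_hasSum hα₁ hpD hy hc fun ξ hξ η hη => huniq u _ hu hsol ξ hξ η hη
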